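/- Let $r\ge 0$ and $d\ge 1$ be integers, let $\alpha=(\alpha_0,\dots,\alpha_r)\in\mathbb R^{r+1}$, and let $(\eta_t)_{t\ge1}$ and $(\varepsilon_t)_{t\ge1}$ be uncorrelated white noises with variances $\sigma_\eta^2>0$ and $\sigma_\varepsilon^2>0$ (with $\sigma_\eta,\sigma_\varepsilon>0$); that is, each of the two is a sequence of independent and identically distributed centred random variables with the given variance, and $\operatorname{Cov}(\eta_s,\varepsilon_t)=0$ for all $s,t\ge1$. Let $\varepsilon_0$ be an arbitrary real random variable. Put $S^{(0)}_t=\eta_t$ for $t\ge1$ and, for $1\le i\le d$, $S^{(i)}_0=0$ and $S^{(i)}_t=S^{(i)}_{t-1}+S^{(i-1)}_t$ for $t\ge1$. For each sample size $T\ge1$ consider $$Z_t=\alpha_0+\alpha_1\frac tT+\dots+\alpha_r\Big(\frac tT\Big)^r+S^{(d)}_t+\varepsilon_t ,\qquad 0\le t\le T .$$ Let $\widehat\alpha_T$ be the (measurable) least squares estimator of $\alpha$ computed from $Z_1,\dots,Z_T$, i.e. a minimizer over $a\in\mathbb R^{r+1}$ of $\sum_{t=1}^T\big(Z_t-\sum_{j=0}^r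 a_j(t/T)^j\big)^2$ (it is unique as soon as $T\ge r+1$), and let $$\widehat\varepsilon_t=Z_t-\sum_{j=0}^r\widehat\alpha_{T,j}\Big(\frac tT\Big)^j,\qquad 0\le t\le T ,$$ be the residuals (the index $t=0$ serves only to define the path below on $0\le\tau<1/T$). Then, as $T\to\infty$, $$\left(\frac{\widehat\varepsilon_{[T\tau]}}{\sigma_\eta\,T^{\,d-1/2}}\right)_{\tau\in[0,1]}\ \overset{\mathcal D}{\longrightarrow}\ \big(W_{r,d-1}(\tau)\big)_{\tau\in[0,1]}$$ weakly in the space $D([0,1])$ of càdlàg functions with the Skorokhod topology. Here $[\cdot]$ is the integer part, $W$ is a standard Wiener process, $W^{(0)}=W$, $W^{(k+1)}(t)=\int_0^tW^{(k)}(s)\,\mathrm ds$, and, for $k\ge0$, $W_{r,k}$ is the detrended Wiener process of order $r\times k$, $$W_{r,k}(t)=W^{(k)}(t)-p_k'\,M^{-1}\Lambda(t),\qquad p_k=\Big(\int_0^1 s^{j}\,W^{(k)}(s)\,\mathrm ds\Big)_{0\le j\le r},$$ with $M=\big(1/(i+j-1)\big)_{1\le i,j\le r+1}$ and $\Lambda(t)=(1,t,\dots,t^r)'$.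 -/

import Mathlib

open MeasureTheory ProbabilityTheory Filter Set
open scoped Topology ENNReal NNReal Matrix

noncomputable section

/-! ### The Skorokhod space `D([0,1])` -/

/-- Càdlàg functions on `[0,1]`: right-continuous with (finite) left limits. -/
structure CadlagPath where
  toFun : unitInterval → ℝ
  right_continuous : ∀ t, ContinuousWithinAt toFun (Ici t) t
  left_limit : ∀ t, ∃ l : ℝ, Tendsto toFun (𝓝[<] t) (𝓝 l)

namespace CadlagPath

instance : CoeFun CadlagPath (fun _ => unitInterval → ℝ) := ⟨CadlagPath.toFun⟩

/-- The size of the deformation of `x` into `y` by a time change `l` (an increasing bijection of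
`[0,1]`): the supremum over `t` of `|l(t) - t|` and `|x(t) - y(l(t))|`. -/
def deformation (x y : CadlagPath) (l : unitInterval ≃o unitInterval) : ℝ≥0∞ :=
  ⨆ t : unitInterval, max (edist (l t) t) (edist (x t) (y (l t)))

theorem deformation_self (x : CadlagPath) : deformation x x (OrderIso.refl _) = 0 := by
  simp [deformation]

theorem deformation_symm (x y : CadlagPath) (l : unitInterval ≃o unitInterval) :
    deformation y x l.symm = deformation x y l := by
  unfold deformation
  rw [← l.toEquiv.iSup_comp
    (g := fun t => max (edist (l.symm t) t) (edist (y t) (x (l.symm t))))]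
  refine iSup_congr fun t => ?_
  simp [edist_comm]

theorem deformation_trans (x y z : CadlagPath) (l m : unitInterval ≃o unitInterval) :
    deformation x z (l.trans m) ≤ deformation x y l + deformation y z m := by
  refine iSup_le fun t => ?_
  have h1 : max (edist (l t) t) (edist (x t) (y (l t))) ≤ deformation x y l :=
    le_iSup (fun t => max (edist (l t) t) (edist (x t) (y (l t)))) t
  have h2 : max (edist (m (l t)) (l t)) (edist (y (l t)) (z (m (l t)))) ≤ deformation y z m :=
    le_iSup (fun t => max (edist (m t) t) (edist (y t) (z (m t)))) (l t)
  refine max_le ?_ ?_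
  · calc edist ((l.trans m) t) t ≤ edist (m (l t)) (l t) + edist (l t) t := edist_triangle _ _ _
      _ ≤ deformation y z m + deformation x y l :=
        add_le_add ((le_max_left _ _).trans h2) ((le_max_left _ _).trans h1)
      _ = _ := add_comm _ _
  · calc edist (x t) (z ((l.trans m) t))
        ≤ edist (x t) (y (l t)) + edist (y (l t)) (z (m (l t))) := edist_triangle _ _ _
      _ ≤ _ := add_le_add ((le_max_right _ _).trans h1) ((le_max_right _ _).trans h2)

/-- The Skorokhod (J1) distance, the infimum over all time changes `l` of the maximum of
`sup |l(t) - t|` and `sup |x(t) - y(l(t))|`. Its topology is the Skorokhod topology. -/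
instance : PseudoEMetricSpace CadlagPath where
  edist x y := ⨅ l : unitInterval ≃o unitInterval, deformation x y l
  edist_self x := le_antisymm ((iInf_le _ (OrderIso.refl _)).trans (deformation_self x).le) bot_le
  edist_comm x y := by
    apply le_antisymm
    · exact le_iInf fun l => (iInf_le _ l.symm).trans (deformation_symm y x l).le
    · exact le_iInf fun l => (iInf_le _ l.symm).trans (deformation_symm x y l).le
  edist_triangle x y z :=
    ENNReal.le_iInf_add_iInf fun l m => (iInf_le _ (l.trans m)).trans (deformation_trans x y z l m)

instance : MeasurableSpace CadlagPath := borel _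
instance : BorelSpace CadlagPath := ⟨rfl⟩

theorem floor_eventually_right (T : ℕ) (t : unitInterval) :
    ∀ᶠ s : unitInterval in 𝓝[≥] t, ⌊(T : ℝ) * (s : ℝ)⌋₊ = ⌊(T : ℝ) * (t : ℝ)⌋₊ := by
  have hc : Continuous fun s : unitInterval => (T : ℝ) * (s : ℝ) := by fun_prop
  have h := (hc.tendsto t).eventually (gt_mem_nhds (Nat.lt_floor_add_one ((T : ℝ) * (t : ℝ))))
  filter_upwards [mem_nhdsWithin_of_mem_nhds h, self_mem_nhdsWithin] with s hs hts
  have h0 : (0 : ℝ) ≤ (T : ℝ) * (t : ℝ) := mul_nonneg T.cast_nonneg t.2.1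
  have hle : (T : ℝ) * (t : ℝ) ≤ (T : ℝ) * (s : ℝ) :=
    mul_le_mul_of_nonneg_left hts T.cast_nonneg
  exact (Nat.floor_eq_iff (h0.trans hle)).2 ⟨(Nat.floor_le h0).trans hle, hs⟩

theorem floor_eventually_left (T : ℕ) (t : unitInterval) :
    ∃ k : ℕ, ∀ᶠ s : unitInterval in 𝓝[<] t, ⌊(T : ℝ) * (s : ℝ)⌋₊ = k := by
  have hc : Continuous fun s : unitInterval => (T : ℝ) * (s : ℝ) := by fun_prop
  have h0 : ∀ s : unitInterval, (0 : ℝ) ≤ (T : ℝ) * (s : ℝ) :=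
    fun s => mul_nonneg T.cast_nonneg s.2.1
  rcases Nat.eq_zero_or_pos ⌈(T : ℝ) * (t : ℝ)⌉₊ with hz | hp
  · refine ⟨0, ?_⟩
    filter_upwards [self_mem_nhdsWithin] with s hs
    have hle : (T : ℝ) * (s : ℝ) ≤ (T : ℝ) * (t : ℝ) :=
      mul_le_mul_of_nonneg_left (le_of_lt hs) T.cast_nonneg
    have := Nat.ceil_eq_zero.1 hz
    exact (Nat.floor_eq_zero).2 (by linarith)
  · obtain ⟨k, hk⟩ := Nat.exists_eq_succ_of_ne_zero hp.ne'
    have hlt : (k : ℝ) < (T : ℝ) * (t : ℝ) := Nat.lt_ceil.1 (by omega)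
    have hge : (T : ℝ) * (t : ℝ) ≤ (k : ℝ) + 1 := by
      have := Nat.le_ceil ((T : ℝ) * (t : ℝ))
      rw [hk] at this
      exact_mod_cast this
    have hT : (0 : ℝ) < T := by
      rcases Nat.eq_zero_or_pos T with h | h
      · subst h
        have : (0 : ℝ) ≤ k := k.cast_nonneg
        simp at hlt
        linarith
      · exact_mod_cast h
    refine ⟨k, ?_⟩
    have h := (hc.tendsto t).eventually (lt_mem_nhds hlt)
    filter_upwards [mem_nhdsWithin_of_mem_nhds h, self_mem_nhdsWithin] with s hs hst
    have : (T : ℝ) * (s : ℝ) < (T : ℝ) * (t : ℝ) := mul_lt_mul_of_pos_left hst hT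
    exact (Nat.floor_eq_iff (h0 s)).2 ⟨hs.le, by linarith⟩

/-- The step function `τ ↦ c [T τ]` on `[0,1]`, `[·]` being the integer part. -/
def step (T : ℕ) (c : ℕ → ℝ) : CadlagPath where
  toFun τ := c ⌊(T : ℝ) * (τ : ℝ)⌋₊
  right_continuous t := by
    refine tendsto_const_nhds.congr' ?_
    filter_upwards [floor_eventually_right T t] with s hs
    rw [hs]
  left_limit t := by
    obtain ⟨k, hk⟩ := floor_eventually_left T t
    refine ⟨c k, tendsto_const_nhds.congr' ?_⟩
    filter_upwards [hk] with s hs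
    rw [hs]

end CadlagPath

/-! ### The regression model -/

/-- A (strong) white noise of variance `σ ^ 2`: independent and identically distributed, centred,
square-integrable random variables. -/
structure IsWhiteNoise {Ω : Type*} [MeasurableSpace Ω] (X : ℕ → Ω → ℝ) (σ : ℝ) (P : Measure Ω) :
    Prop where
  indep : iIndepFun X P
  identDistrib : ∀ t, IdentDistrib (X t) (X 0) P P
  memLp : ∀ t, MemLp (X t) 2 P
  mean : ∀ t, ∫ ω, X t ω ∂P = 0
  variance : ∀ t, Var[X t; P] = σ ^ 2

/-- The `d`-fold integrated random walk: `S⁽⁰⁾ = η` and `S⁽ᵈ⁺¹⁾ t = S⁽ᵈ⁾ 1 + ⋯ + S⁽ᵈ⁾ t`, that is,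
`S⁽ᵈ⁺¹⁾ 0 = 0` and `S⁽ᵈ⁺¹⁾ t = S⁽ᵈ⁺¹⁾ (t - 1) + S⁽ᵈ⁾ t` for `t ≥ 1`. -/
def integratedWalk (η : ℕ → ℝ) : ℕ → ℕ → ℝ
  | 0 => η
  | d + 1 => fun t => ∑ k ∈ Finset.Icc 1 t, integratedWalk η d k

/-- The polynomial trend `a₀ + a₁ x + ⋯ + a_r x ^ r`. -/
def polyTrend {r : ℕ} (a : Fin (r + 1) → ℝ) (x : ℝ) : ℝ :=
  ∑ j : Fin (r + 1), a j * x ^ (j : ℕ)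

/-- The series `Z_t = α₀ + α₁ (t/T) + ⋯ + α_r (t/T) ^ r + S⁽ᵈ⁾_t + ε_t` for sample size `T`. -/
def trendSeries {r : ℕ} (α : Fin (r + 1) → ℝ) (d : ℕ) (η ε : ℕ → ℝ) (T t : ℕ) : ℝ :=
  polyTrend α ((t : ℝ) / T) + integratedWalk η d t + ε t

/-- The residual at time `t` when the trend with coefficients `a` is fitted to `z`. -/
def trendResidual {r : ℕ} (T : ℕ) (z : ℕ → ℝ) (a : Fin (r + 1) → ℝ) (t : ℕ) : ℝ :=
  z t - polyTrend a ((t : ℝ) / T)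

/-- `a` is a least squares estimate of the trend from the observations `z 1, …, z T`: it minimizes
the residual sum of squares. -/
def IsLeastSquares {r : ℕ} (T : ℕ) (z : ℕ → ℝ) (a : Fin (r + 1) → ℝ) : Prop :=
  ∀ b : Fin (r + 1) → ℝ,
    ∑ t ∈ Finset.Icc 1 T, trendResidual T z a t ^ 2 ≤
      ∑ t ∈ Finset.Icc 1 T, trendResidual T z b t ^ 2

/-! ### The detrended Wiener process -/

/-- Iterated primitives: `w⁽⁰⁾ = w` and `w⁽ᵈ⁺¹⁾(t) = ∫₀ᵗ w⁽ᵈ⁾(s) ds`. -/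
def iteratedPrimitive (w : ℝ → ℝ) : ℕ → ℝ → ℝ
  | 0 => w
  | d + 1 => fun t => ∫ s in (0 : ℝ)..t, iteratedPrimitive w d s

/-- The matrix `M` with entries `1 / (i + j - 1)`, `1 ≤ i, j ≤ r + 1` (here indexed from `0`). -/
def trendGram (r : ℕ) : Matrix (Fin (r + 1)) (Fin (r + 1)) ℝ :=
  Matrix.of fun i j => 1 / ((i : ℝ) + (j : ℝ) + 1)

/-- The vector `Λ(t) = (1, t, …, t ^ r)`. -/
def trendVector (r : ℕ) (t : ℝ) : Fin (r + 1) → ℝ := fun j => t ^ (j : ℕ)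

/-- The vector `(∫₀ᵗ w⁽ᵈ⁾(s) ds, ∫₀ᵗ s w⁽ᵈ⁾(s) ds, …, ∫₀ᵗ s ^ r w⁽ᵈ⁾(s) ds)`; its first entry is
`w⁽ᵈ⁺¹⁾(t)`. -/
def trendMoments (r d : ℕ) (w : ℝ → ℝ) (t : ℝ) : Fin (r + 1) → ℝ :=
  fun j => ∫ s in (0 : ℝ)..t, s ^ (j : ℕ) * iteratedPrimitive w d s

/-- The path at time `t` of the detrended process of order `r × d` built from the path `w`:
`w⁽ᵈ⁾(t) - p' M⁻¹ Λ(t)`, where `p` has the entries `∫₀¹ s ^ j w⁽ᵈ⁾(s) ds`, `0 ≤ j ≤ r`. -/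
def detrended (r d : ℕ) (w : ℝ → ℝ) (t : ℝ) : ℝ :=
  iteratedPrimitive w d t - trendMoments r d w 1 ⬝ᵥ ((trendGram r)⁻¹ *ᵥ trendVector r t)

end

/-!
The residual path is, up to a uniformly small error, a continuous image of the random walk of `η`,
and the theorem is Donsker's invariance principle pushed through this map.

The argument uses finite-dimensional approximations throughout, so that neither tightness criteria
nor weak convergence in a space of continuous functions is needed. Divide `{0, …, T}` into `m`
blocks and let `b` be the vector of the sums of `η` over the blocks, divided by `σ √T`. Three facts
are combined by `tendstoInDistribution_of_approx`, a general approximation theorem for weak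
convergence.

* For fixed `m`, the vector `b` converges in law, as `T → ∞`, to the increments of the Wiener
  process over the intervals `[i / m, (i + 1) / m]`: the central limit theorem applies to each
  block, and independence makes the convergence joint
  (`IsWhiteNoise.tendstoInDistribution_blockSums`). Interpolating to a polygon, integrating `d - 1`
  times and detrending is a continuous map from `ℝ ^ m` to the Skorokhod space
  (`continuous_detrendedPolygon`).
* As `m → ∞`, the polygons through a Wiener path converge to it uniformly on `[0, 1]`
  (`tendsto_detrendedPolygon`).
* The residual path is within `C (o + e)` of the image of the polygon with increments `b`, where
  `o` is the largest oscillation of the normalized walk within a block and `e` bounds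
  `|ε t| / (σ √T)` for `t ≤ T`. This is a deterministic statement
  (`exists_abs_step_sub_detrended_le`). Both `o` and `e` are small in probability: for `o` this is
  Ottaviani's maximal inequality together with the Gaussian limit of the block sums
  (`IsWhiteNoise.eventually_measure_not_blockOscLE_le`), for `e` a union bound and square
  integrability (`IsWhiteNoise.tendsto_measure_exists_abs_gt`).

The deterministic part rests on one observation. If `f` is the polygon and `T ≥ m`, then `f`
oscillates by at most `2 o` at scale `1 / T` and is bounded by `2 o T` (`SlowlyVarying`). Hence
replacing integrals of `f` by sums over the grid `t / T`, or the moments `1 / (i + j + 1)` by the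
sample moments of the regressors, which are within `O(1 / T)` of them, costs `O(o)`. The least
squares coefficients only enter through their normal equations, and only the Gram matrix of the
monomials in `L²(0, 1)` has to be inverted.
-/

/-! ### Polygonal paths -/

/-- The identity of `ℝ` clamped to `[0, 1]`. -/
noncomputable def ramp (x : ℝ) : ℝ := max 0 (min 1 x)

theorem continuous_ramp : Continuous ramp := by unfold ramp; fun_prop

theorem monotone_ramp : Monotone ramp := fun x y h => by unfold ramp; gcongr

theorem ramp_of_one_le {x : ℝ} (h : 1 ≤ x) : ramp x = 1 := by simp [ramp, h]

theorem ramp_of_nonpos {x : ℝ} (h : x ≤ 0) : ramp x = 0 := by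
  simp only [ramp, max_eq_left_iff]
  exact (min_le_right _ _).trans h

/-- Adding up ramps that start at `0, 1, …, m - 1` gives the identity clamped to `[0, m]`. -/
theorem sum_ramp (m : ℕ) (x : ℝ) :
    ∑ i ∈ Finset.range m, ramp (x - i) = max 0 (min (m : ℝ) x) := by
  induction m with
  | zero => simp
  | succ m ih =>
    rw [Finset.sum_range_succ, ih]
    have hm : (0 : ℝ) ≤ m := m.cast_nonneg
    push_cast
    unfold ramp
    rcases le_total x 0 with h | h <;> rcases le_total x m with h' | h' <;>
      rcases le_total x (m + 1) with h'' | h'' <;> grind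

/-- The polygonal path on `[0, 1]` with knots `i / m`, starting at `0`, whose increment over
`[i / m, (i + 1) / m]` is `b i`. -/
noncomputable def polygon (m : ℕ) (b : Fin m → ℝ) (x : ℝ) : ℝ :=
  ∑ i : Fin m, b i * ramp (m * x - (i : ℕ))

theorem continuous_polygon (m : ℕ) (b : Fin m → ℝ) : Continuous (polygon m b) := by
  have := continuous_ramp
  unfold polygon
  fun_prop

theorem polygon_sub (m : ℕ) (b b' : Fin m → ℝ) (x : ℝ) :
    polygon m (b - b') x = polygon m b x - polygon m b' x := by
  simp [polygon, sub_mul]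

theorem abs_polygon_sub_le {m : ℕ} {b : Fin m → ℝ} {o : ℝ} (hb : ∀ i, |b i| ≤ o) (x y : ℝ) :
    |polygon m b x - polygon m b y| ≤ o * (m * |x - y|) := by
  wlog hxy : y ≤ x generalizing x y
  · rw [abs_sub_comm, abs_sub_comm x y]
    exact this y x (le_of_not_ge hxy)
  have hm : (0 : ℝ) ≤ m := m.cast_nonneg
  rcases Nat.eq_zero_or_pos m with rfl | hm0
  · simp [polygon]
  have ho : 0 ≤ o := (abs_nonneg _).trans (hb ⟨0, hm0⟩)
  have hmxy : (m : ℝ) * y ≤ m * x := by gcongr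
  calc |polygon m b x - polygon m b y|
      = |∑ i : Fin m, b i * (ramp (m * x - (i : ℕ)) - ramp (m * y - (i : ℕ)))| := by
        simp [polygon, mul_sub]
    _ ≤ ∑ i : Fin m, |b i * (ramp (m * x - (i : ℕ)) - ramp (m * y - (i : ℕ)))| :=
        Finset.abs_sum_le_sum_abs _ _
    _ ≤ ∑ i : Fin m, o * (ramp (m * x - (i : ℕ)) - ramp (m * y - (i : ℕ))) := by
        refine Finset.sum_le_sum fun i _ => ?_
        have h0 : 0 ≤ ramp (m * x - (i : ℕ)) - ramp (m * y - (i : ℕ)) :=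
          sub_nonneg.2 (monotone_ramp (by linarith))
        rw [abs_mul, abs_of_nonneg h0]
        exact mul_le_mul_of_nonneg_right (hb i) h0
    _ = o * (max 0 (min (m : ℝ) (m * x)) - max 0 (min (m : ℝ) (m * y))) := by
        rw [← Finset.mul_sum, Finset.sum_sub_distrib, ← sum_ramp, ← sum_ramp,
          Fin.sum_univ_eq_sum_range (fun i : ℕ => ramp (m * x - i)),
          Fin.sum_univ_eq_sum_range (fun i : ℕ => ramp (m * y - i))]
    _ ≤ o * (m * |x - y|) := by
        rw [abs_of_nonneg (sub_nonneg.2 hxy)]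
        gcongr
        rw [mul_sub]
        generalize (m : ℝ) * x = u at hmxy ⊢
        generalize (m : ℝ) * y = w at hmxy ⊢
        rcases le_total (m : ℝ) u <;> rcases le_total (m : ℝ) w <;> rcases le_total 0 u <;>
          rcases le_total 0 w <;> simp [*] <;> linarith

theorem polygon_zero {m : ℕ} (b : Fin m → ℝ) : polygon m b 0 = 0 := by
  refine Finset.sum_eq_zero fun i _ => ?_
  rw [ramp_of_nonpos (by simp), mul_zero]

theorem abs_polygon_le {m : ℕ} {b : Fin m → ℝ} {o : ℝ} (hb : ∀ i, |b i| ≤ o) {x : ℝ}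
    (hx : x ∈ Icc (0 : ℝ) 1) : |polygon m b x| ≤ o * m := by
  have h := abs_polygon_sub_le hb x 0
  rw [polygon_zero, sub_zero, sub_zero, abs_of_nonneg hx.1] at h
  rcases Nat.eq_zero_or_pos m with rfl | hm0
  · simp [polygon]
  have ho : 0 ≤ o := (abs_nonneg _).trans (hb ⟨0, hm0⟩)
  refine h.trans ?_
  gcongr
  exact mul_le_of_le_one_right m.cast_nonneg hx.2

/-- A polygon takes the prescribed values at its knots. -/
theorem polygon_knot {m : ℕ} (hm : 0 < m) (v : ℕ → ℝ) {j : ℕ} (hj : j ≤ m) :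
    polygon m (fun i => v (i + 1) - v i) (j / m) = v j - v 0 := by
  have hm' : (m : ℝ) ≠ 0 := by positivity
  unfold polygon
  rw [mul_div_cancel₀ _ hm',
    Fin.sum_univ_eq_sum_range (fun i : ℕ => (v (i + 1) - v i) * ramp (j - i)),
    ← Finset.sum_range_add_sum_Ico _ hj, Finset.sum_eq_zero (s := Finset.Ico j m), add_zero,
    ← Finset.sum_range_sub]
  · refine Finset.sum_congr rfl fun i hi => ?_
    rw [ramp_of_one_le, mul_one]
    have : (i : ℝ) + 1 ≤ j := by exact_mod_cast Finset.mem_range.1 hi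
    linarith
  · intro i hi
    rw [ramp_of_nonpos, mul_zero]
    have : (j : ℝ) ≤ i := by exact_mod_cast (Finset.mem_Ico.1 hi).1
    linarith

/-- If a function stays within `o` of the value it has at the left knot of each mesh interval,
then so does, up to a factor `2`, its polygonal interpolation. -/
theorem abs_sub_polygon_le {m : ℕ} (hm : 0 < m) {v : ℕ → ℝ} (hv0 : v 0 = 0) {o y x : ℝ}
    (hb : ∀ i < m, |v (i + 1) - v i| ≤ o) {i : ℕ} (hi : i ≤ m)
    (hx : |x - i / m| ≤ 1 / m) (hy : |y - v i| ≤ o) :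
    |y - polygon m (fun i => v (i + 1) - v i) x| ≤ 2 * o := by
  have hm' : (0 : ℝ) < m := by exact_mod_cast hm
  have h1 := abs_polygon_sub_le (fun i : Fin m => hb i i.2) x (i / m)
  rw [polygon_knot hm v hi, hv0, sub_zero] at h1
  have ho : 0 ≤ o := (abs_nonneg _).trans hy
  have h2 : o * (m * |x - i / m|) ≤ o * 1 := by
    gcongr
    calc (m : ℝ) * |x - i / m| ≤ m * (1 / m) := by gcongr
      _ = 1 := by field_simp
  rw [abs_sub_comm] at h1
  calc |y - polygon m (fun i => v (i + 1) - v i) x|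
      ≤ |y - v i| + |v i - polygon m (fun i => v (i + 1) - v i) x| := abs_sub_le _ _ _
    _ ≤ 2 * o := by linarith

/-! ### Riemann sums and iterated primitives -/

/-- Comparison of a Riemann sum with the integral: the error is at most the distance `a` of the
data to the function plus the oscillation `b` of the function at scale `1 / T`. -/
theorem abs_riemannSum_sub_integral_le {T : ℕ} (hT : 0 < T) {c : ℕ → ℝ} {g : ℝ → ℝ}
    (hg : Continuous g) {a b : ℝ} (hc : ∀ t, 1 ≤ t → t ≤ T → |c t - g (t / T)| ≤ a)
    (hosc : ∀ x ∈ Icc (0 : ℝ) 1, ∀ y ∈ Icc (0 : ℝ) 1, |x - y| ≤ 1 / T → |g x - g y| ≤ b)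
    {t : ℕ} (ht : t ≤ T) :
    |1 / (T : ℝ) * ∑ k ∈ Finset.Icc 1 t, c k - ∫ s in (0 : ℝ)..(t / T), g s| ≤ a + b := by
  have hT' : (0 : ℝ) < T := by exact_mod_cast hT
  have ha : 0 ≤ a := (abs_nonneg _).trans (hc T hT le_rfl)
  have hb : 0 ≤ b :=
    (abs_nonneg _).trans (hosc 0 (by simp) 0 (by simp) (by simp))
  have key : ∀ n ≤ T, |1 / (T : ℝ) * ∑ k ∈ Finset.Icc 1 n, c k - ∫ s in (0 : ℝ)..(n / T), g s|
      ≤ (a + b) * (n / T) := by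
    intro n
    induction n with
    | zero => intro _; simp
    | succ n ih =>
      intro hn
      have ih' := ih (by omega)
      have hn1 : ((n : ℝ) + 1) / T ≤ 1 := by
        rw [div_le_one hT']; exact_mod_cast hn
      have hn0 : (0 : ℝ) ≤ n / T := by positivity
      have hstep : ((n : ℝ) + 1) / T = n / T + 1 / T := by ring
      have hpos : (0 : ℝ) < 1 / T := by positivity
      rw [Finset.sum_Icc_succ_top (by omega), Nat.cast_succ]
      have hsplit : ∫ s in (0 : ℝ)..(((n : ℝ) + 1) / T), g s =
          (∫ s in (0 : ℝ)..(n / T), g s) + ∫ s in (n / T : ℝ)..(((n : ℝ) + 1) / T), g s :=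
        (intervalIntegral.integral_add_adjacent_intervals (hg.intervalIntegrable _ _)
          (hg.intervalIntegrable _ _)).symm
      have hlast : |1 / (T : ℝ) * c (n + 1) - ∫ s in (n / T : ℝ)..(((n : ℝ) + 1) / T), g s|
          ≤ (a + b) * (1 / T) := by
        have h1 : 1 / (T : ℝ) * c (n + 1) =
            ∫ _ in (n / T : ℝ)..(((n : ℝ) + 1) / T), c (n + 1) := by
          rw [intervalIntegral.integral_const, hstep, smul_eq_mul]
          ring
        rw [h1, ← intervalIntegral.integral_sub (by simp) (hg.intervalIntegrable _ _)]
        have h2 := intervalIntegral.norm_integral_le_of_norm_le_const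
          (f := fun s => c (n + 1) - g s) (C := a + b) (a := n / T) (b := ((n : ℝ) + 1) / T) ?_
        · rwa [Real.norm_eq_abs, hstep, add_sub_cancel_left, abs_of_pos hpos, ← hstep] at h2
        · intro s hs
          rw [uIoc_of_le (by rw [hstep]; linarith)] at hs
          have h3 := hc (n + 1) (by omega) hn
          rw [Nat.cast_succ] at h3
          have h4 := hosc (((n : ℝ) + 1) / T) ⟨by positivity, hn1⟩ s
            ⟨by linarith [hs.1], by linarith [hs.2]⟩ (by
              rw [abs_of_nonneg (by linarith [hs.2]), hstep]
              linarith [hs.1])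
          calc ‖c (n + 1) - g s‖ ≤ |c (n + 1) - g (((n : ℝ) + 1) / T)| +
                |g (((n : ℝ) + 1) / T) - g s| := abs_sub_le _ _ _
            _ ≤ a + b := add_le_add h3 h4
      calc _ = |(1 / (T : ℝ) * ∑ k ∈ Finset.Icc 1 n, c k - ∫ s in (0 : ℝ)..(n / T), g s) +
            (1 / (T : ℝ) * c (n + 1) - ∫ s in (n / T : ℝ)..(((n : ℝ) + 1) / T), g s)| := by
            rw [hsplit]; congr 1; ring
        _ ≤ _ := abs_add_le _ _
        _ ≤ (a + b) * (n / T) + (a + b) * (1 / T) := add_le_add ih' hlast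
        _ = _ := by ring
  refine (key t ht).trans (mul_le_of_le_one_right (by positivity) ?_)
  rw [div_le_one hT']
  exact_mod_cast ht

theorem continuous_iteratedPrimitive {w : ℝ → ℝ} (hw : Continuous w) (k : ℕ) :
    Continuous (iteratedPrimitive w k) := by
  induction k with
  | zero => exact hw
  | succ k ih =>
    exact intervalIntegral.continuous_primitive (fun a b => ih.intervalIntegrable a b) 0

/-- The partial sums `η 1 + ⋯ + η t` normalized as in Donsker's theorem. -/
noncomputable def scaledWalk (η : ℕ → ℝ) (σ : ℝ) (T t : ℕ) : ℝ :=
  (∑ k ∈ Finset.Icc 1 t, η k) / (σ * √T)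

theorem rpow_scale {T : ℕ} (hT : 0 < T) (k : ℕ) :
    (T : ℝ) ^ (((k + 1 : ℕ) : ℝ) - 1 / 2) = (T : ℝ) ^ k * √T := by
  have hT' : (0 : ℝ) < T := by exact_mod_cast hT
  rw [Real.sqrt_eq_rpow, ← Real.rpow_natCast, ← Real.rpow_add hT']
  congr 1
  push_cast
  ring

theorem integratedWalk_two_scaled (η : ℕ → ℝ) (σ : ℝ) (T k t : ℕ) :
    integratedWalk η (k + 2) t / (σ * ((T : ℝ) ^ (k + 1) * √T)) =
      1 / (T : ℝ) * ∑ j ∈ Finset.Icc 1 t, integratedWalk η (k + 1) j / (σ * ((T : ℝ) ^ k * √T)) := by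
  rw [← Finset.sum_div]
  change (∑ j ∈ Finset.Icc 1 t, integratedWalk η (k + 1) j) / _ = _
  rw [div_mul_div_comm, one_mul]
  congr 1
  ring

/-- `f` is bounded by `κ T` on `[0, 1]` and oscillates by at most `κ` at scale `1 / T`. With `κ`
small, sums over the grid `t / T` approximate integrals of `f`, also after integration or after
multiplication by a power. -/
structure SlowlyVarying (f : ℝ → ℝ) (κ : ℝ) (T : ℕ) : Prop where
  continuous : Continuous f
  bound : ∀ x ∈ Icc (0 : ℝ) 1, |f x| ≤ κ * T
  osc : ∀ x ∈ Icc (0 : ℝ) 1, ∀ y ∈ Icc (0 : ℝ) 1, |x - y| ≤ 1 / T → |f x - f y| ≤ κ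

theorem SlowlyVarying.nonneg {f : ℝ → ℝ} {κ : ℝ} {T : ℕ} (h : SlowlyVarying f κ T) : 0 ≤ κ :=
  (abs_nonneg _).trans (h.osc 0 (by simp) 0 (by simp) (by simp))

theorem SlowlyVarying.primitive {f : ℝ → ℝ} {κ : ℝ} {T : ℕ} (hT : 0 < T)
    (h : SlowlyVarying f κ T) : SlowlyVarying (fun t => ∫ s in (0 : ℝ)..t, f s) κ T := by
  have hT' : (0 : ℝ) < T := by exact_mod_cast hT
  have key : ∀ x ∈ Icc (0 : ℝ) 1, ∀ y ∈ Icc (0 : ℝ) 1,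
      |∫ s in x..y, f s| ≤ κ * T * |y - x| := fun x hx y hy => by
    rw [← Real.norm_eq_abs (∫ s in x..y, f s)]
    exact intervalIntegral.norm_integral_le_of_norm_le_const fun s hs =>
      h.bound s (uIcc_subset_Icc hx hy (uIoc_subset_uIcc hs))
  have hκ := h.nonneg
  refine ⟨continuous_iteratedPrimitive h.continuous 1, fun x hx => ?_, fun x hx y hy hxy => ?_⟩
  · refine (key 0 (by simp) x hx).trans (mul_le_of_le_one_right (by positivity) ?_)
    rw [sub_zero, abs_of_nonneg hx.1]
    exact hx.2
  · rw [intervalIntegral.integral_interval_sub_left (h.continuous.intervalIntegrable _ _)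
      (h.continuous.intervalIntegrable _ _)]
    calc _ ≤ κ * T * |x - y| := key y hy x hx
      _ ≤ κ * T * (1 / T) := by gcongr
      _ = κ := by field_simp

theorem SlowlyVarying.iteratedPrimitive {f : ℝ → ℝ} {κ : ℝ} {T : ℕ} (hT : 0 < T)
    (h : SlowlyVarying f κ T) (k : ℕ) : SlowlyVarying (iteratedPrimitive f k) κ T := by
  induction k with
  | zero => exact h
  | succ k ih => exact ih.primitive hT

/-- Iterated sums of the data follow the iterated primitives of the function that they follow. -/
theorem abs_integratedWalk_sub_iteratedPrimitive_le {η : ℕ → ℝ} {σ : ℝ} {T : ℕ} (hT : 0 < T)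
    {f : ℝ → ℝ} {κ : ℝ} (hf : SlowlyVarying f κ T)
    (hw : ∀ t ≤ T, |scaledWalk η σ T t - f (t / T)| ≤ κ) (k : ℕ) :
    ∀ t ≤ T, |integratedWalk η (k + 1) t / (σ * ((T : ℝ) ^ k * √T)) -
      iteratedPrimitive f k (t / T)| ≤ (k + 1) * κ := by
  induction k with
  | zero =>
    intro t ht
    simpa [integratedWalk, scaledWalk, iteratedPrimitive] using hw t ht
  | succ k ih =>
    intro t ht
    have hk := hf.iteratedPrimitive hT k
    rw [integratedWalk_two_scaled]
    refine (abs_riemannSum_sub_integral_le hT hk.continuous (fun t _ ht => ih t ht) hk.osc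
      ht).trans (le_of_eq ?_)
    push_cast
    ring

/-! ### Detrending -/

theorem continuous_polyTrend {r : ℕ} (a : Fin (r + 1) → ℝ) : Continuous (polyTrend a) := by
  unfold polyTrend
  fun_prop

theorem polyTrend_eq_dotProduct {r : ℕ} (a : Fin (r + 1) → ℝ) (x : ℝ) :
    polyTrend a x = a ⬝ᵥ trendVector r x := rfl

theorem abs_pow_sub_pow_le_of_mem_Icc {x y : ℝ} (hx : x ∈ Icc (0 : ℝ) 1) (hy : y ∈ Icc (0 : ℝ) 1) (j : ℕ) :
    |x ^ j - y ^ j| ≤ j * |x - y| := by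
  have h : max |x| |y| ≤ 1 := by
    rw [abs_of_nonneg hx.1, abs_of_nonneg hy.1]
    exact max_le hx.2 hy.2
  have h0 : 0 ≤ max |x| |y| := (abs_nonneg x).trans (le_max_left _ _)
  refine (abs_pow_sub_pow_le x y j).trans ?_
  rw [mul_comm |x - y|]
  exact mul_le_of_le_one_right (by positivity) (pow_le_one₀ h0 h)

theorem abs_polyTrend_le {r : ℕ} {a : Fin (r + 1) → ℝ} {N : ℝ} (ha : ∀ i, |a i| ≤ N) {x : ℝ}
    (hx : x ∈ Icc (0 : ℝ) 1) : |polyTrend a x| ≤ (r + 1) * N := by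
  calc |polyTrend a x| ≤ ∑ j : Fin (r + 1), |a j * x ^ (j : ℕ)| := Finset.abs_sum_le_sum_abs _ _
    _ ≤ ∑ _j : Fin (r + 1), N := by
        refine Finset.sum_le_sum fun j _ => ?_
        rw [abs_mul, abs_of_nonneg (pow_nonneg hx.1 _)]
        exact (mul_le_of_le_one_right (abs_nonneg _) (pow_le_one₀ hx.1 hx.2)).trans (ha j)
    _ = _ := by simp

theorem abs_polyTrend_sub_le {r : ℕ} {a : Fin (r + 1) → ℝ} {N : ℝ} (ha : ∀ i, |a i| ≤ N) {x y : ℝ}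
    (hx : x ∈ Icc (0 : ℝ) 1) (hy : y ∈ Icc (0 : ℝ) 1) :
    |polyTrend a x - polyTrend a y| ≤ (r + 1) * (N * (r * |x - y|)) := by
  have hN : 0 ≤ N := (abs_nonneg _).trans (ha 0)
  calc |polyTrend a x - polyTrend a y|
      = |∑ j : Fin (r + 1), a j * (x ^ (j : ℕ) - y ^ (j : ℕ))| := by
        simp [polyTrend, mul_sub]
    _ ≤ ∑ j : Fin (r + 1), |a j * (x ^ (j : ℕ) - y ^ (j : ℕ))| := Finset.abs_sum_le_sum_abs _ _
    _ ≤ ∑ _j : Fin (r + 1), N * (r * |x - y|) := by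
        refine Finset.sum_le_sum fun j _ => ?_
        rw [abs_mul]
        have hj : ((j : ℕ) : ℝ) ≤ r := by exact_mod_cast Nat.lt_succ_iff.1 j.2
        gcongr
        · exact ha j
        · exact (abs_pow_sub_pow_le_of_mem_Icc hx hy _).trans (by gcongr)
    _ = _ := by simp

/-- The quadratic form of the Gram matrix of the monomials in `L²(0, 1)`. -/
theorem integral_polyTrend_sq {r : ℕ} (a : Fin (r + 1) → ℝ) :
    ∫ s in (0 : ℝ)..1, polyTrend a s ^ 2 = (a ᵥ* trendGram r) ⬝ᵥ a := by
  have h : ∀ s : ℝ, polyTrend a s ^ 2 =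
      ∑ j : Fin (r + 1), ∑ i : Fin (r + 1), a i * a j * s ^ ((i : ℕ) + (j : ℕ)) := by
    intro s
    rw [pow_two, polyTrend, Finset.sum_mul_sum, Finset.sum_comm]
    refine Finset.sum_congr rfl fun j _ => Finset.sum_congr rfl fun i _ => ?_
    ring
  simp_rw [h]
  rw [intervalIntegral.integral_finsetSum fun j _ =>
    (Continuous.intervalIntegrable (by fun_prop) _ _)]
  refine Finset.sum_congr rfl fun j _ => ?_
  rw [intervalIntegral.integral_finsetSum fun j _ =>
    (Continuous.intervalIntegrable (by fun_prop) _ _), Matrix.vecMul, dotProduct, Finset.sum_mul]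
  refine Finset.sum_congr rfl fun i _ => ?_
  rw [intervalIntegral.integral_const_mul, integral_pow]
  simp [trendGram]
  ring

theorem eq_zero_of_polyTrend_eq_zero {r : ℕ} {a : Fin (r + 1) → ℝ}
    (h : ∀ x ∈ Icc (0 : ℝ) 1, polyTrend a x = 0) : a = 0 := by
  have hev : ∀ x, (∑ i : Fin (r + 1), Polynomial.C (a i) * Polynomial.X ^ (i : ℕ)).eval x =
      polyTrend a x := fun x => by
    simp [Polynomial.eval_finsetSum, polyTrend]
  have hz : (∑ i : Fin (r + 1), Polynomial.C (a i) * Polynomial.X ^ (i : ℕ)) = 0 := by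
    refine Polynomial.eq_zero_of_infinite_isRoot _ ((Icc_infinite (zero_lt_one (α := ℝ))).mono ?_)
    intro x hx
    change Polynomial.eval x _ = 0
    rw [hev, h x hx]
  ext i
  have := congrArg (fun p => Polynomial.coeff p (i : ℕ)) hz
  simpa [Polynomial.finsetSum_coeff, Polynomial.coeff_C_mul, Polynomial.coeff_X_pow,
    Fin.val_inj] using this

/-- The Gram matrix of the monomials is invertible: they are linearly independent. -/
theorem isUnit_det_trendGram (r : ℕ) : IsUnit (trendGram r).det := by
  rw [isUnit_iff_ne_zero]
  intro hdet
  obtain ⟨a, ha, h⟩ := Matrix.exists_vecMul_eq_zero_iff.2 hdet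
  refine ha (eq_zero_of_polyTrend_eq_zero fun x hx => ?_)
  have h0 : ∫ s in (0 : ℝ)..1, polyTrend a s ^ 2 = 0 := by
    rw [integral_polyTrend_sq, h, zero_dotProduct]
  by_contra hne
  have hpos : 0 < ∫ s in (0 : ℝ)..1, polyTrend a s ^ 2 :=
    intervalIntegral.integral_pos zero_lt_one
      ((continuous_polyTrend a).pow 2).continuousOn (fun _ _ => sq_nonneg _) ⟨x, hx, by positivity⟩
  exact hpos.ne' h0

/-- A bound for the inverse of the Gram matrix as an operator for the sup norm. -/
noncomputable def gramInvBound (r : ℕ) : ℝ := ∑ i, ∑ j, |(trendGram r)⁻¹ i j|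

theorem gramInvBound_nonneg (r : ℕ) : 0 ≤ gramInvBound r :=
  Finset.sum_nonneg fun _ _ => Finset.sum_nonneg fun _ _ => abs_nonneg _

theorem abs_vecMul_inv_trendGram_le {r : ℕ} {p : Fin (r + 1) → ℝ} {b : ℝ} (hp : ∀ i, |p i| ≤ b)
    (j : Fin (r + 1)) : |(p ᵥ* (trendGram r)⁻¹) j| ≤ gramInvBound r * b := by
  calc |(p ᵥ* (trendGram r)⁻¹) j| ≤ ∑ i, |p i * (trendGram r)⁻¹ i j| := by
        rw [Matrix.vecMul, dotProduct]
        exact Finset.abs_sum_le_sum_abs _ _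
    _ ≤ ∑ i, (∑ j, |(trendGram r)⁻¹ i j|) * b := by
        refine Finset.sum_le_sum fun i _ => ?_
        rw [abs_mul, mul_comm]
        have hb := (abs_nonneg _).trans (hp i)
        have h1 : |(trendGram r)⁻¹ i j| ≤ ∑ j, |(trendGram r)⁻¹ i j| :=
          Finset.single_le_sum (f := fun j => |(trendGram r)⁻¹ i j|) (fun _ _ => abs_nonneg _)
            (Finset.mem_univ j)
        gcongr
        exact hp i
    _ = _ := by rw [gramInvBound, Finset.sum_mul]

/-- The coefficients of the `L²(0, 1)`-projection of `f` on the polynomials of degree at most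
`r`. -/
noncomputable def trendCoeff (r : ℕ) (f : ℝ → ℝ) : Fin (r + 1) → ℝ :=
  (fun j : Fin (r + 1) => ∫ s in (0 : ℝ)..1, s ^ (j : ℕ) * f s) ᵥ* (trendGram r)⁻¹

theorem detrended_eq (r k : ℕ) (w : ℝ → ℝ) (t : ℝ) :
    detrended r k w t =
      iteratedPrimitive w k t - polyTrend (trendCoeff r (iteratedPrimitive w k)) t := by
  rw [detrended, Matrix.dotProduct_mulVec]
  rfl

theorem abs_moment_le {f : ℝ → ℝ} {b : ℝ} (hf : ∀ x ∈ Icc (0 : ℝ) 1, |f x| ≤ b) (j : ℕ) :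
    |∫ s in (0 : ℝ)..1, s ^ j * f s| ≤ b := by
  have h := intervalIntegral.norm_integral_le_of_norm_le_const (a := (0 : ℝ)) (b := 1)
    (f := fun s => s ^ j * f s) (C := b) ?_
  · simpa using h
  · intro s hs
    rw [uIoc_of_le zero_le_one] at hs
    have hs' : s ∈ Icc (0 : ℝ) 1 := ⟨hs.1.le, hs.2⟩
    rw [Real.norm_eq_abs, abs_mul, abs_of_nonneg (pow_nonneg hs'.1 j)]
    exact (mul_le_of_le_one_left (abs_nonneg _) (pow_le_one₀ hs'.1 hs'.2)).trans (hf s hs')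

theorem trendCoeff_sub (r : ℕ) {f g : ℝ → ℝ} (hf : Continuous f) (hg : Continuous g) :
    trendCoeff r (fun x => f x - g x) = trendCoeff r f - trendCoeff r g := by
  rw [trendCoeff, trendCoeff, trendCoeff, ← Matrix.sub_vecMul]
  congr 1
  ext j
  simp only [Pi.sub_apply]
  rw [← intervalIntegral.integral_sub (Continuous.intervalIntegrable (by fun_prop) _ _)
    (Continuous.intervalIntegrable (by fun_prop) _ _)]
  simp only [mul_sub]

theorem abs_iteratedPrimitive_sub_le {f g : ℝ → ℝ} (hf : Continuous f) (hg : Continuous g) {δ : ℝ}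
    (h : ∀ x ∈ Icc (0 : ℝ) 1, |f x - g x| ≤ δ) (k : ℕ) :
    ∀ x ∈ Icc (0 : ℝ) 1, |iteratedPrimitive f k x - iteratedPrimitive g k x| ≤ δ := by
  induction k with
  | zero => exact h
  | succ k ih =>
    intro x hx
    have hδ : 0 ≤ δ := (abs_nonneg _).trans (h 0 (by simp))
    rw [iteratedPrimitive, iteratedPrimitive, ← intervalIntegral.integral_sub
      ((continuous_iteratedPrimitive hf k).intervalIntegrable _ _)
      ((continuous_iteratedPrimitive hg k).intervalIntegrable _ _), ← Real.norm_eq_abs]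
    refine (intervalIntegral.norm_integral_le_of_norm_le_const fun s hs => ?_).trans
      (mul_le_of_le_one_right hδ ?_)
    · exact ih s (uIcc_subset_Icc (by simp) hx (uIoc_subset_uIcc hs))
    · rw [sub_zero, abs_of_nonneg hx.1]
      exact hx.2

theorem continuous_detrended (r k : ℕ) {w : ℝ → ℝ} (hw : Continuous w) :
    Continuous (detrended r k w) := by
  rw [funext (detrended_eq r k w)]
  exact (continuous_iteratedPrimitive hw k).sub (continuous_polyTrend _)

/-- Iterated integration followed by detrending is Lipschitz for the sup norm on `[0, 1]`. -/
theorem abs_detrended_sub_le (r k : ℕ) {f g : ℝ → ℝ} (hf : Continuous f) (hg : Continuous g)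
    {δ : ℝ} (h : ∀ x ∈ Icc (0 : ℝ) 1, |f x - g x| ≤ δ) {x : ℝ} (hx : x ∈ Icc (0 : ℝ) 1) :
    |detrended r k f x - detrended r k g x| ≤ (1 + (r + 1) * gramInvBound r) * δ := by
  have hF := continuous_iteratedPrimitive hf k
  have hG := continuous_iteratedPrimitive hg k
  have h1 := abs_iteratedPrimitive_sub_le hf hg h k
  have h2 := abs_polyTrend_le (abs_vecMul_inv_trendGram_le fun j : Fin (r + 1) =>
    abs_moment_le h1 j) hx
  change |polyTrend (trendCoeff r _) x| ≤ _ at h2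
  rw [trendCoeff_sub r hF hG, polyTrend_eq_dotProduct, sub_dotProduct, ← polyTrend_eq_dotProduct,
    ← polyTrend_eq_dotProduct] at h2
  rw [detrended_eq, detrended_eq]
  generalize iteratedPrimitive f k = F at *
  generalize iteratedPrimitive g k = G at *
  calc _ = |(F x - G x) - (polyTrend (trendCoeff r F) x - polyTrend (trendCoeff r G) x)| := by
        congr 1; ring
    _ ≤ |F x - G x| + |polyTrend (trendCoeff r F) x - polyTrend (trendCoeff r G) x| := abs_sub _ _
    _ ≤ δ + (r + 1) * (gramInvBound r * δ) := add_le_add (h1 x hx) h2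
    _ = _ := by ring

/-- The normal equations of the least squares problem. -/
theorem IsLeastSquares.normal_equations {r T : ℕ} {z : ℕ → ℝ} {a : Fin (r + 1) → ℝ}
    (h : IsLeastSquares T z a) (j : Fin (r + 1)) :
    ∑ t ∈ Finset.Icc 1 T, trendResidual T z a t * ((t : ℝ) / T) ^ (j : ℕ) = 0 := by
  set A := ∑ t ∈ Finset.Icc 1 T, trendResidual T z a t * ((t : ℝ) / T) ^ (j : ℕ) with hA
  set B := ∑ t ∈ Finset.Icc 1 T, (((t : ℝ) / T) ^ (j : ℕ)) ^ 2 with hB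
  have hB0 : 0 ≤ B := Finset.sum_nonneg fun _ _ => sq_nonneg _
  have key : ∀ s : ℝ, 0 ≤ -2 * s * A + s ^ 2 * B := by
    intro s
    have h1 := h (a + s • Pi.single j 1)
    have h2 : ∀ t : ℕ, trendResidual T z (a + s • Pi.single j 1) t =
        trendResidual T z a t - s * ((t : ℝ) / T) ^ (j : ℕ) := by
      intro t
      simp only [trendResidual, polyTrend_eq_dotProduct, add_dotProduct, smul_dotProduct,
        single_dotProduct, trendVector, one_mul, smul_eq_mul]
      ring
    have h3 : ∑ t ∈ Finset.Icc 1 T, trendResidual T z (a + s • Pi.single j 1) t ^ 2 =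
        ∑ t ∈ Finset.Icc 1 T, trendResidual T z a t ^ 2 + (-2 * s * A + s ^ 2 * B) := by
      rw [hA, hB, Finset.mul_sum, Finset.mul_sum, ← Finset.sum_add_distrib,
        ← Finset.sum_add_distrib]
      refine Finset.sum_congr rfl fun t _ => ?_
      rw [h2]
      ring
    linarith
  -- the quadratic is minimal at `A / B`; `A / (B + 1)` avoids the case distinction on `B = 0`
  have h1 := key (A / (B + 1))
  have h2 : -2 * (A / (B + 1)) * A + (A / (B + 1)) ^ 2 * B = -(A ^ 2 * (B + 2)) / (B + 1) ^ 2 := by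
    field_simp
    ring
  rw [h2, div_nonneg_iff] at h1
  have h4 : 0 ≤ A ^ 2 * (B + 2) := by positivity
  have h3 : A ^ 2 * (B + 2) = 0 := by
    rcases h1 with h1 | h1
    · linarith [h1.1]
    · have : (B + 1) ^ 2 > 0 := by positivity
      linarith [h1.2]
  have : B + 2 ≠ 0 := by positivity
  simpa [this] using h3

theorem SlowlyVarying.pow_mul {f : ℝ → ℝ} {κ : ℝ} {T : ℕ} (hT : 0 < T)
    (h : SlowlyVarying f κ T) (j : ℕ) : ∀ x ∈ Icc (0 : ℝ) 1, ∀ y ∈ Icc (0 : ℝ) 1,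
      |x - y| ≤ 1 / T → |x ^ j * f x - y ^ j * f y| ≤ (1 + j) * κ := by
  intro x hx y hy hxy
  have hT' : (0 : ℝ) < T := by exact_mod_cast hT
  have h1 := h.osc x hx y hy hxy
  have h2 := h.bound y hy
  have hκ := h.nonneg
  calc |x ^ j * f x - y ^ j * f y| = |x ^ j * (f x - f y) + (x ^ j - y ^ j) * f y| := by
        congr 1; ring
    _ ≤ |x ^ j| * |f x - f y| + |x ^ j - y ^ j| * |f y| := by
        rw [← abs_mul, ← abs_mul]; exact abs_add_le _ _
    _ ≤ 1 * κ + (j * (1 / T)) * (κ * T) := by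
        gcongr
        · rw [abs_of_nonneg (pow_nonneg hx.1 j)]
          exact pow_le_one₀ hx.1 hx.2
        · exact (abs_pow_sub_pow_le_of_mem_Icc hx hy j).trans (by gcongr)
    _ = _ := by field_simp

theorem natCast_div_mem_Icc {t T : ℕ} (ht : t ≤ T) : (t : ℝ) / T ∈ Icc (0 : ℝ) 1 :=
  ⟨by positivity, div_le_one_of_le₀ (by exact_mod_cast ht) T.cast_nonneg⟩

/-- The least squares coefficients `β` of data following `F` nearly solve the normal equations of
the continuous problem. The error is allowed to involve `β` itself, with a factor `1 / T`, which
avoids inverting the Gram matrix of the sample. -/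
theorem abs_vecMul_trendGram_sub_le {r T : ℕ} (hT : 0 < T) {F : ℝ → ℝ} {κ a : ℝ}
    (hF : SlowlyVarying F κ T) {w : ℕ → ℝ} (hw : ∀ t ≤ T, |w t - F (t / T)| ≤ a)
    {β : Fin (r + 1) → ℝ}
    (hβ : ∀ j : Fin (r + 1),
      ∑ t ∈ Finset.Icc 1 T, (w t - polyTrend β (t / T)) * ((t : ℝ) / T) ^ (j : ℕ) = 0)
    {N : ℝ} (hN : ∀ i, |β i| ≤ N) (j : Fin (r + 1)) :
    |(β ᵥ* trendGram r) j - ∫ s in (0 : ℝ)..1, s ^ (j : ℕ) * F s| ≤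
      a + (1 + r) * κ + (r + 1) * (N * (2 * r / T)) := by
  have hT' : (0 : ℝ) < T := by exact_mod_cast hT
  have hj : ((j : ℕ) : ℝ) ≤ r := by exact_mod_cast Nat.lt_succ_iff.1 j.2
  have hFc := hF.continuous
  have hN0 : 0 ≤ N := (abs_nonneg _).trans (hN 0)
  -- sums of powers against integrals of powers
  have hpow : ∀ i : Fin (r + 1), |1 / (T : ℝ) * ∑ t ∈ Finset.Icc 1 T,
      ((t : ℝ) / T) ^ ((i : ℕ) + j) - trendGram r i j| ≤ 2 * r / T := by
    intro i
    have hi : ((i : ℕ) : ℝ) ≤ r := by exact_mod_cast Nat.lt_succ_iff.1 i.2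
    have := abs_riemannSum_sub_integral_le hT (c := fun t => ((t : ℝ) / T) ^ ((i : ℕ) + j))
      (g := fun s => s ^ ((i : ℕ) + j)) (by fun_prop) (a := 0) (b := 2 * r / T) (by simp)
      (fun x hx y hy hxy => (abs_pow_sub_pow_le_of_mem_Icc hx hy _).trans (by
        calc (((i : ℕ) + j : ℕ) : ℝ) * |x - y| ≤ (2 * r) * (1 / T) := by
              gcongr
              push_cast
              linarith
          _ = _ := by ring)) le_rfl
    rw [div_self hT'.ne', integral_pow] at this
    simpa [trendGram] using this
  have hmom := abs_riemannSum_sub_integral_le hT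
    (c := fun t => (t / T : ℝ) ^ (j : ℕ) * w t) (g := fun s => s ^ (j : ℕ) * F s) (by fun_prop)
    (a := a) (b := (1 + r) * κ) (fun t _ ht => by
      have h := natCast_div_mem_Icc ht
      rw [← mul_sub, abs_mul, abs_of_nonneg (pow_nonneg h.1 _)]
      exact (mul_le_of_le_one_left (abs_nonneg _) (pow_le_one₀ h.1 h.2)).trans (hw t ht))
    (fun x hx y hy hxy => (hF.pow_mul hT j x hx y hy hxy).trans (by
      have := hF.nonneg
      gcongr)) le_rfl
  rw [div_self hT'.ne'] at hmom
  have hsum : 1 / (T : ℝ) * ∑ t ∈ Finset.Icc 1 T, (t / T : ℝ) ^ (j : ℕ) * w t =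
      ∑ i, β i * (1 / (T : ℝ) * ∑ t ∈ Finset.Icc 1 T, ((t : ℝ) / T) ^ ((i : ℕ) + j)) := by
    have h := hβ j
    simp_rw [sub_mul, Finset.sum_sub_distrib, sub_eq_zero] at h
    simp_rw [mul_comm (_ ^ (j : ℕ)) (w _)]
    rw [h]
    simp_rw [polyTrend, Finset.sum_mul]
    rw [Finset.sum_comm, Finset.mul_sum]
    refine Finset.sum_congr rfl fun i _ => ?_
    simp_rw [mul_left_comm (β i), pow_add, mul_assoc, Finset.mul_sum]
  rw [hsum] at hmom
  have hdiff : |(β ᵥ* trendGram r) j - ∑ i, β i * (1 / (T : ℝ) *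
      ∑ t ∈ Finset.Icc 1 T, ((t : ℝ) / T) ^ ((i : ℕ) + j))| ≤ (r + 1) * (N * (2 * r / T)) := by
    rw [Matrix.vecMul, dotProduct, ← Finset.sum_sub_distrib]
    calc _ ≤ ∑ i, |β i * trendGram r i j - β i * (1 / (T : ℝ) *
          ∑ t ∈ Finset.Icc 1 T, ((t : ℝ) / T) ^ ((i : ℕ) + j))| := Finset.abs_sum_le_sum_abs _ _
      _ ≤ ∑ _i : Fin (r + 1), N * (2 * r / T) := by
          refine Finset.sum_le_sum fun i _ => ?_
          rw [← mul_sub, abs_mul, abs_sub_comm]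
          gcongr
          · exact hN i
          · exact hpow i
      _ = _ := by simp
  calc _ ≤ _ := abs_sub_le _ _ _
    _ ≤ (r + 1) * (N * (2 * r / T)) + (a + (1 + r) * κ) := add_le_add hdiff hmom
    _ = _ := by ring

/-- The least squares coefficients of data following `F` are close to the coefficients of the
`L²(0, 1)`-projection of `F`. -/
theorem exists_abs_sub_trendCoeff_le (r : ℕ) : ∃ C ≥ (0 : ℝ), ∃ T₀ : ℕ, ∀ T ≥ T₀, 0 < T →
    ∀ (F : ℝ → ℝ) (κ a : ℝ), SlowlyVarying F κ T → ∀ w : ℕ → ℝ,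
    (∀ t ≤ T, |w t - F (t / T)| ≤ a) → ∀ β : Fin (r + 1) → ℝ,
    (∀ j : Fin (r + 1),
      ∑ t ∈ Finset.Icc 1 T, (w t - polyTrend β (t / T)) * ((t : ℝ) / T) ^ (j : ℕ) = 0) →
    ∀ i, |β i - trendCoeff r F i| ≤ C * (a + κ) := by
  set K := gramInvBound r with hK
  have hK0 : 0 ≤ K := gramInvBound_nonneg r
  refine ⟨2 * K * (1 + r + (r + 1) * (2 * r) * K), by positivity,
    ⌈2 * (K * ((r + 1) * (2 * r)))⌉₊, ?_⟩
  intro T hTT hT F κ a hF w hw β hβ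
  have hT' : (0 : ℝ) < T := by exact_mod_cast hT
  have hTT' : 2 * (K * ((r + 1) * (2 * r))) ≤ T := (Nat.le_ceil _).trans (by exact_mod_cast hTT)
  have hκ := hF.nonneg
  have ha : 0 ≤ a := (abs_nonneg _).trans (hw 0 (Nat.zero_le _))
  set γ := trendCoeff r F with hγ
  set N := ‖β - γ‖ with hN
  have hγb : ∀ i, |γ i| ≤ K * (κ * T) := fun i =>
    abs_vecMul_inv_trendGram_le (fun j : Fin (r + 1) => abs_moment_le hF.bound j) i
  have hNi : ∀ i, |β i - γ i| ≤ N := fun i => norm_le_pi_norm (β - γ) i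
  have hβb : ∀ i, |β i| ≤ N + K * (κ * T) := fun i => by
    have := abs_add_le (β i - γ i) (γ i)
    rw [sub_add_cancel] at this
    linarith [hNi i, hγb i]
  have h1 := abs_vecMul_trendGram_sub_le hT hF hw hβ hβb
  have hinv : β - γ = (β ᵥ* trendGram r -
      fun j : Fin (r + 1) => ∫ s in (0 : ℝ)..1, s ^ (j : ℕ) * F s) ᵥ* (trendGram r)⁻¹ := by
    rw [Matrix.sub_vecMul, Matrix.vecMul_vecMul, Matrix.mul_nonsing_inv _ (isUnit_det_trendGram r),
      Matrix.vecMul_one]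
    rfl
  set E := a + (1 + r) * κ + (r + 1) * ((N + K * (κ * T)) * (2 * r / T)) with hE
  have hE0 : 0 ≤ E := by positivity
  have h2 : N ≤ K * E := by
    refine (pi_norm_le_iff_of_nonneg (by positivity)).2 fun i => ?_
    rw [Real.norm_eq_abs, hinv]
    exact abs_vecMul_inv_trendGram_le h1 i
  have h3 : K * E = K * (a + (1 + r) * κ + (r + 1) * (2 * r) * K * κ) +
      N * ((K * ((r + 1) * (2 * r))) / T) := by
    rw [hE]
    field_simp
    ring
  have h4 : N * ((K * ((r + 1) * (2 * r))) / T) ≤ N * (1 / 2) := by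
    have : 0 ≤ N := norm_nonneg _
    refine mul_le_mul_of_nonneg_left ?_ this
    rw [div_le_iff₀ hT']
    linarith
  have hr : (0 : ℝ) ≤ r := r.cast_nonneg
  intro i
  calc |β i - γ i| ≤ N := hNi i
    _ ≤ 2 * K * (a + (1 + r) * κ + (r + 1) * (2 * r) * K * κ) := by linarith
    _ ≤ 2 * K * ((1 + r + (r + 1) * (2 * r) * K) * (a + κ)) := by
        gcongr
        have : 0 ≤ (r + (r + 1) * (2 * r) * K) * a := by positivity
        nlinarith
    _ = _ := by ring

/-- The residual path of data following a slowly varying function `F` is uniformly close to the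
detrended function. -/
theorem exists_abs_residual_sub_le (r : ℕ) : ∃ C ≥ (0 : ℝ), ∃ T₀ : ℕ, ∀ T ≥ T₀, 0 < T →
    ∀ (F : ℝ → ℝ) (κ a : ℝ), SlowlyVarying F κ T → ∀ w : ℕ → ℝ,
    (∀ t ≤ T, |w t - F (t / T)| ≤ a) → ∀ β : Fin (r + 1) → ℝ,
    (∀ j : Fin (r + 1),
      ∑ t ∈ Finset.Icc 1 T, (w t - polyTrend β (t / T)) * ((t : ℝ) / T) ^ (j : ℕ) = 0) →
    ∀ x ∈ Icc (0 : ℝ) 1, |(w ⌊T * x⌋₊ - polyTrend β (⌊T * x⌋₊ / T)) -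
      (F x - polyTrend (trendCoeff r F) x)| ≤ C * (a + κ) := by
  obtain ⟨C, hC, T₀, h⟩ := exists_abs_sub_trendCoeff_le r
  set K := gramInvBound r with hK
  have hK0 : 0 ≤ K := gramInvBound_nonneg r
  refine ⟨1 + (r + 1) * C + (r + 1) * (K * r), by positivity, T₀, ?_⟩
  intro T hTT hT F κ a hF w hw β hβ x hx
  have hT' : (0 : ℝ) < T := by exact_mod_cast hT
  have hκ := hF.nonneg
  have ha : 0 ≤ a := (abs_nonneg _).trans (hw 0 (Nat.zero_le _))
  have hβγ := h T hTT hT F κ a hF w hw β hβ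
  set γ := trendCoeff r F with hγ
  have hγb : ∀ i, |γ i| ≤ K * (κ * T) := fun i =>
    abs_vecMul_inv_trendGram_le (fun j : Fin (r + 1) => abs_moment_le hF.bound j) i
  have hfl : (⌊T * x⌋₊ : ℝ) ≤ T * x := Nat.floor_le (mul_nonneg hT'.le hx.1)
  have hfl' : T * x < ⌊T * x⌋₊ + 1 := Nat.lt_floor_add_one _
  have htT : ⌊T * x⌋₊ ≤ T := by
    have : (⌊T * x⌋₊ : ℝ) ≤ T := hfl.trans (mul_le_of_le_one_right hT'.le hx.2)
    exact_mod_cast this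
  set t := ⌊T * x⌋₊ with ht
  have hy := natCast_div_mem_Icc htT
  have hyx : |(t : ℝ) / T - x| ≤ 1 / T := by
    rw [abs_sub_comm, abs_of_nonneg (sub_nonneg.2 ((div_le_iff₀ hT').2 (by linarith)))]
    rw [sub_le_iff_le_add, ← add_div, le_div_iff₀ hT']
    linarith
  set y := (t : ℝ) / T with hyd
  have e1 := hw t htT
  have e2 := hF.osc y hy x hx hyx
  have e3 := abs_polyTrend_le hβγ hy
  have e4 := abs_polyTrend_sub_le hγb hy hx
  have e5 : (r + 1 : ℝ) * (K * (κ * T) * (r * |y - x|)) ≤ (r + 1) * (K * r) * κ := by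
    calc (r + 1 : ℝ) * (K * (κ * T) * (r * |y - x|))
        ≤ (r + 1) * (K * (κ * T) * (r * (1 / T))) := by gcongr
      _ = _ := by field_simp
  have e6 : polyTrend (fun i => β i - γ i) y = polyTrend β y - polyTrend γ y := by
    simp [polyTrend, sub_mul]
  rw [e6] at e3
  calc _ = |(w t - F y) + (F y - F x) - (polyTrend β y - polyTrend γ y) -
        (polyTrend γ y - polyTrend γ x)| := by congr 1; ring
    _ ≤ |w t - F y| + |F y - F x| + |polyTrend β y - polyTrend γ y| +
        |polyTrend γ y - polyTrend γ x| :=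
      (abs_sub _ _).trans (add_le_add ((abs_sub _ _).trans
        (add_le_add (abs_add_le _ _) le_rfl)) le_rfl)
    _ ≤ a + κ + (r + 1) * (C * (a + κ)) + (r + 1) * (K * r) * κ := by
        gcongr
        exact e4.trans e5
    _ ≤ _ := by
        have : 0 ≤ (r + 1) * (K * r) * a := by positivity
        nlinarith

/-! ### Weak convergence by approximation -/

/-- Points of `G` at distance more than `1 / (n + 1)` from its complement. -/
def innerOpen {E : Type*} [PseudoEMetricSpace E] (G : Set E) (n : ℕ) : Set E :=
  {x | ENNReal.ofReal (1 / ((n : ℝ) + 1)) < Metric.infEDist x Gᶜ}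

theorem isOpen_innerOpen {E : Type*} [PseudoEMetricSpace E] (G : Set E) (n : ℕ) :
    IsOpen (innerOpen G n) :=
  isOpen_lt continuous_const Metric.continuous_infEDist

theorem monotone_innerOpen {E : Type*} [PseudoEMetricSpace E] (G : Set E) :
    Monotone (innerOpen G) := fun m n hmn x hx => by
  refine lt_of_le_of_lt (ENNReal.ofReal_le_ofReal ?_) hx
  exact one_div_le_one_div_of_le (by positivity) (by gcongr)

theorem iUnion_innerOpen {E : Type*} [PseudoEMetricSpace E] {G : Set E} (hG : IsOpen G) :
    ⋃ n, innerOpen G n = G := by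
  ext x
  simp only [mem_iUnion, innerOpen, mem_ofPred_eq]
  constructor
  · rintro ⟨n, hn⟩
    by_contra hx
    rw [Metric.infEDist_zero_of_mem (show x ∈ Gᶜ from hx)] at hn
    exact not_lt_bot hn
  · intro hx
    have hpos : 0 < Metric.infEDist x Gᶜ := by
      rw [pos_iff_ne_zero, Ne, ← Metric.mem_iff_infEDist_zero_of_closed hG.isClosed_compl]
      exact fun h => h hx
    have hlim : Tendsto (fun n : ℕ => ENNReal.ofReal (1 / ((n : ℝ) + 1))) atTop (𝓝 0) := by
      rw [← ENNReal.ofReal_zero]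
      exact ENNReal.tendsto_ofReal tendsto_one_div_add_atTop_nhds_zero_nat
    exact (hlim.eventually (gt_mem_nhds hpos)).exists

/-- Weak convergence of approximations implies weak convergence: `U m n` converges in law to
`Z m` as `n → ∞`, `Z m → Z` almost surely, and `U m n` is close to `X n` in probability, for `m`
large and then `n` large. -/
theorem tendstoInDistribution_of_approx {E Ω Ω' : Type*} [PseudoEMetricSpace E]
    [MeasurableSpace E] [BorelSpace E] [MeasurableSpace Ω] [MeasurableSpace Ω'] {P : Measure Ω}
    [IsProbabilityMeasure P] {Q : Measure Ω'} [IsProbabilityMeasure Q] {X : ℕ → Ω → E}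
    (hX : ∀ n, AEMeasurable (X n) P) {U : ℕ → ℕ → Ω → E} {Z' : ℕ → Ω' → E} {Z : Ω' → E}
    (hU : ∀ m, 0 < m → TendstoInDistribution (U m) atTop (Z' m) (fun _ => P) Q)
    (hZ' : ∀ᵐ ω ∂Q, Tendsto (fun m => Z' m ω) atTop (𝓝 (Z ω)))
    (hXU : ∀ δ > (0 : ℝ), ∀ θ > (0 : ℝ), ∀ᶠ m in atTop, ∀ᶠ n in atTop,
      P {ω | ENNReal.ofReal δ < edist (X n ω) (U m n ω)} ≤ ENNReal.ofReal θ) :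
    TendstoInDistribution X atTop Z (fun _ => P) Q := by
  have hZ'm : ∀ m, AEMeasurable (Z' (m + 1)) Q := fun m => (hU _ m.succ_pos).aemeasurable_limit
  have hZ's : ∀ᵐ ω ∂Q, Tendsto (fun m => Z' (m + 1) ω) atTop (𝓝 (Z ω)) := by
    filter_upwards [hZ'] with ω h using h.comp (tendsto_add_atTop_nat 1)
  have hZ : AEMeasurable Z Q := aemeasurable_of_tendsto_metrizable_ae' hZ'm hZ's
  have hZZ := tendstoInDistribution_of_ae_tendsto hZ'm hZ hZ's
  refine ⟨hX, hZ, tendsto_of_forall_isOpen_le_liminf' fun G hG => ?_⟩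
  change Q.map Z G ≤ liminf (fun n => P.map (X n) G) atTop
  rw [Measure.map_apply_of_aemeasurable hZ hG.measurableSet]
  have hin : Tendsto (fun n => Q (Z ⁻¹' innerOpen G n)) atTop (𝓝 (Q (Z ⁻¹' G))) := by
    have := tendsto_measure_iUnion_atTop (μ := Q) (s := fun n => Z ⁻¹' innerOpen G n)
      fun m n hmn => preimage_mono (monotone_innerOpen G hmn)
    rwa [← preimage_iUnion, iUnion_innerOpen hG] at this
  refine le_of_tendsto' hin fun N => ?_
  set δ : ℝ := 1 / ((N : ℝ) + 1) with hδ
  have hδ0 : 0 < δ := by positivity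
  have hGN := isOpen_innerOpen G N
  -- the open set criterion for `Z' (m + 1) → Z` and then for `U (m + 1) n → Z' (m + 1)`
  have h1 : Q (Z ⁻¹' innerOpen G N) ≤
      liminf (fun m => Q (Z' (m + 1) ⁻¹' innerOpen G N)) atTop := by
    have := ProbabilityMeasure.le_liminf_measure_open_of_tendsto hZZ.tendsto hGN
    change Q.map Z _ ≤ liminf (fun m => Q.map (Z' (m + 1)) _) atTop at this
    rw [Measure.map_apply_of_aemeasurable hZ hGN.measurableSet] at this
    simpa only [Measure.map_apply_of_aemeasurable (hZ'm _) hGN.measurableSet] using this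
  have h2 : ∀ m, Q (Z' (m + 1) ⁻¹' innerOpen G N) ≤
      liminf (fun n => P (U (m + 1) n ⁻¹' innerOpen G N)) atTop := by
    intro m
    have h := hU _ m.succ_pos
    have := ProbabilityMeasure.le_liminf_measure_open_of_tendsto h.tendsto hGN
    change Q.map (Z' (m + 1)) _ ≤ liminf (fun n => P.map (U (m + 1) n) _) atTop at this
    rw [Measure.map_apply_of_aemeasurable (hZ'm m) hGN.measurableSet] at this
    simpa only [Measure.map_apply_of_aemeasurable (h.forall_aemeasurable _) hGN.measurableSet]
      using this
  have h3 : ∀ m n, P (U m n ⁻¹' innerOpen G N) ≤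
      P.map (X n) G + P {ω | ENNReal.ofReal δ < edist (X n ω) (U m n ω)} := by
    intro m n
    rw [Measure.map_apply_of_aemeasurable (hX n) hG.measurableSet]
    refine (measure_mono fun ω hω => ?_).trans (measure_union_le _ _)
    by_contra hcon
    simp only [mem_union, mem_preimage, mem_ofPred_eq, not_or, not_lt] at hcon
    have : Metric.infEDist (U m n ω) Gᶜ ≤ ENNReal.ofReal δ :=
      (Metric.infEDist_le_edist_of_mem (show X n ω ∈ Gᶜ from hcon.1)).trans
        (by rw [edist_comm]; exact hcon.2)
    exact absurd hω (not_lt.2 this)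
  refine le_of_forall_lt_imp_le_of_dense fun c hc => ?_
  -- `c < Q (Z ∈ innerOpen G N)`: absorb an error `θ` below the gap
  obtain ⟨c', hcc', hc'⟩ := exists_between hc
  obtain ⟨c'', hcc'', hc''⟩ := exists_between hcc'
  have hctop : c ≠ ⊤ := (hcc''.trans_le le_top).ne
  obtain ⟨θ, hθ0, hθ⟩ : ∃ θ > (0 : ℝ), c + ENNReal.ofReal θ ≤ c'' := by
    have hc''top : c'' ≠ ⊤ := (hc''.trans_le le_top).ne
    refine ⟨(c'' - c).toReal, ENNReal.toReal_pos (tsub_pos_of_lt hcc'').ne'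
      (ENNReal.sub_ne_top hc''top), ?_⟩
    rw [ENNReal.ofReal_toReal (ENNReal.sub_ne_top hc''top), add_tsub_cancel_of_le hcc''.le]
  have h4 : ∀ᶠ m in atTop, c' < Q (Z' (m + 1) ⁻¹' innerOpen G N) :=
    eventually_lt_of_lt_liminf (hc'.trans_le h1)
  have h5 := (tendsto_add_atTop_nat 1).eventually (hXU δ hδ0 θ hθ0)
  obtain ⟨m, hm4, hm5⟩ := (h4.and h5).exists
  have h6 : ∀ᶠ n in atTop, c'' < P (U (m + 1) n ⁻¹' innerOpen G N) :=
    eventually_lt_of_lt_liminf ((hc''.trans hm4).trans_le (h2 m))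
  refine le_liminf_of_le (by isBoundedDefault) ?_
  filter_upwards [h6, hm5] with n hn6 hn5
  have h7 : c + ENNReal.ofReal θ ≤ P.map (X n) G + ENNReal.ofReal θ :=
    hθ.trans (hn6.le.trans ((h3 _ _).trans (by gcongr)))
  exact (ENNReal.add_le_add_iff_right ENNReal.ofReal_ne_top).1 h7

/-! ### Elements of the Skorokhod space -/

namespace CadlagPath

theorem ext_toFun {x y : CadlagPath} (h : ∀ t, x t = y t) : x = y := by
  cases x
  cases y
  congr
  exact funext h

/-- The Skorokhod distance is at most the uniform distance. -/
theorem edist_le_of_abs_sub_le {x y : CadlagPath} {δ : ℝ} (h : ∀ t, |x t - y t| ≤ δ) :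
    edist x y ≤ ENNReal.ofReal δ := by
  refine (iInf_le _ (OrderIso.refl _)).trans (iSup_le fun t => ?_)
  simp only [OrderIso.refl_apply, edist_self, zero_le, max_eq_right]
  rw [edist_dist, Real.dist_eq]
  exact ENNReal.ofReal_le_ofReal (h t)

/-- The restriction of a continuous function to `[0, 1]`. -/
def ofContinuous (f : ℝ → ℝ) (hf : Continuous f) : CadlagPath where
  toFun τ := f τ
  right_continuous _ := (hf.comp continuous_subtype_val).continuousWithinAt
  left_limit t := ⟨f t, ((hf.comp continuous_subtype_val).tendsto t).mono_left nhdsWithin_le_nhds⟩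

/-- Linear bounds give continuity of a family of paths with finitely many parameters. -/
theorem continuous_of_abs_sub_le {ι : Type*} [Fintype ι] {Φ : (ι → ℝ) → CadlagPath} {C : ℝ}
    (h : ∀ b b' t, |Φ b t - Φ b' t| ≤ C * dist b b') : Continuous Φ := by
  refine LipschitzWith.continuous (K := C.toNNReal) fun b b' => ?_
  have h1 : edist (Φ b) (Φ b') ≤ ENNReal.ofReal (C.toNNReal * dist b b') :=
    edist_le_of_abs_sub_le fun t => (h b b' t).trans
      (mul_le_mul_of_nonneg_right (Real.le_coe_toNNReal C) dist_nonneg)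
  rwa [ENNReal.ofReal_mul (by simp), ENNReal.ofReal_coe_nnreal, ← edist_dist] at h1

theorem aemeasurable_step {Ω : Type*} [MeasurableSpace Ω] {P : Measure Ω} {T : ℕ}
    {c : Ω → ℕ → ℝ} (hc : ∀ t ≤ T, AEMeasurable (fun ω => c ω t) P) :
    AEMeasurable (fun ω => step T (c ω)) P := by
  let Φ : (Fin (T + 1) → ℝ) → CadlagPath := fun b =>
    step T fun t => if h : t < T + 1 then b ⟨t, h⟩ else 0
  have hΦ : Continuous Φ := by
    refine continuous_of_abs_sub_le (C := 1) fun b b' τ => ?_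
    change |(if h : ⌊(T : ℝ) * τ⌋₊ < T + 1 then b ⟨_, h⟩ else 0) -
      (if h : ⌊(T : ℝ) * τ⌋₊ < T + 1 then b' ⟨_, h⟩ else 0)| ≤ _
    rw [one_mul]
    split_ifs
    · exact dist_le_pi_dist b b' _
    · simp
  have heq : (fun ω => step T (c ω)) = fun ω => Φ fun t => c ω t := by
    ext1 ω
    refine ext_toFun fun τ => ?_
    have hτ : ⌊(T : ℝ) * τ⌋₊ ≤ T := Nat.floor_le_of_le
      (mul_le_of_le_one_right T.cast_nonneg τ.2.2)
    change c ω ⌊(T : ℝ) * τ⌋₊ = if h : ⌊(T : ℝ) * τ⌋₊ < T + 1 then c ω _ else 0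
    rw [dif_pos (Nat.lt_succ_of_le hτ)]
  rw [heq]
  exact hΦ.measurable.comp_aemeasurable
    (aemeasurable_pi_lambda _ fun t => hc t (Nat.lt_succ_iff.1 t.2))

end CadlagPath

/-! ### A maximal inequality -/

section Maximal

variable {Ω : Type*} [MeasurableSpace Ω] {P : Measure Ω} [IsProbabilityMeasure P]
  {X : ℕ → Ω → ℝ}

theorem sum_coe_ite_mem {s t : Finset ℕ} (hst : s ⊆ t) (f : ℕ → ℝ) :
    ∑ j : t, (if (j : ℕ) ∈ s then f j else 0) = ∑ j ∈ s, f j := by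
  rw [Finset.sum_coe_sort t fun j => if j ∈ s then f j else 0, ← Finset.sum_filter]
  congr 1
  ext a
  simp only [Finset.mem_filter, and_iff_right_iff_imp]
  exact fun h => hst h

theorem measurable_sum_coe_ite_mem (s t : Finset ℕ) :
    Measurable fun x : t → ℝ => ∑ j : t, (if (j : ℕ) ∈ s then x j else 0) :=
  Finset.measurable_sum _ fun j _ => by split_ifs <;> fun_prop

/-- Chebyshev's inequality for a sum of independent centred random variables. -/
theorem measure_abs_sum_gt_le (hind : iIndepFun X P) (hL : ∀ j, MemLp (X j) 2 P)
    (hmean : ∀ j, ∫ ω, X j ω ∂P = 0) {v : ℝ} (hvar : ∀ j, Var[X j; P] = v) (s : Finset ℕ)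
    {l : ℝ} (hl : 0 < l) :
    P {ω | l < |∑ j ∈ s, X j ω|} ≤ ENNReal.ofReal (s.card * v / l ^ 2) := by
  have hLs : MemLp (∑ j ∈ s, X j) 2 P := memLp_finsetSum' _ fun j _ => hL j
  have h0 : ∫ ω, (∑ j ∈ s, X j) ω ∂P = 0 := by
    simp only [Finset.sum_apply]
    rw [integral_finsetSum _ fun j _ => (hL j).integrable (by norm_num)]
    exact Finset.sum_eq_zero fun j _ => hmean j
  have h := meas_ge_le_variance_div_sq hLs hl
  rw [h0, IndepFun.variance_sum (fun j _ => hL j) fun i _ j _ hij => hind.indepFun hij,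
    Finset.sum_congr rfl fun j _ => hvar j, Finset.sum_const, nsmul_eq_mul] at h
  refine (measure_mono fun ω hω => ?_).trans h
  simp only [mem_ofPred_eq, sub_zero, Finset.sum_apply] at hω ⊢
  exact hω.le

/-- **Ottaviani's inequality**: when sums of at most `n` terms exceed `l` with probability at most
`1 / 2`, which `hn` ensures by Chebyshev's inequality, the maximum of the partial sums is controlled
by the last one. The reason is that the sum of the terms after the first passage above `2 l` is
independent of the past, and is at most `l` with probability at least `1 / 2`. -/
theorem measure_max_abs_sum_gt_le (hind : iIndepFun X P) (hL : ∀ j, MemLp (X j) 2 P)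
    (hmean : ∀ j, ∫ ω, X j ω ∂P = 0) {v : ℝ} (hv : 0 ≤ v) (hvar : ∀ j, Var[X j; P] = v)
    {n : ℕ} {l : ℝ} (hl : 0 < l) (hn : n * v ≤ l ^ 2 / 2) :
    P {ω | ∃ k ≤ n, 2 * l < |∑ j ∈ Finset.range k, X j ω|} ≤
      2 * P {ω | l < |∑ j ∈ Finset.range n, X j ω|} := by
  have hX : ∀ j, AEMeasurable (X j) P := fun j => (hL j).1.aemeasurable
  have hS : ∀ s : Finset ℕ, AEMeasurable (fun ω => ∑ j ∈ s, X j ω) P :=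
    fun s => Finset.aemeasurable_fun_sum s fun j _ => hX j
  -- `A k`: the threshold `2 l` is first exceeded at time `k`
  let A : ℕ → Set Ω := fun k => {ω | 2 * l < |∑ j ∈ Finset.range k, X j ω| ∧
    ∀ i < k, |∑ j ∈ Finset.range i, X j ω| ≤ 2 * l}
  let B : ℕ → Set Ω := fun k => {ω | |∑ j ∈ Finset.Ico k n, X j ω| ≤ l}
  have hAm : ∀ k, NullMeasurableSet (A k) P := by
    intro k
    have h1 : NullMeasurableSet {ω | 2 * l < |∑ j ∈ Finset.range k, X j ω|} P :=
      (hS _).nullMeasurable (measurableSet_lt measurable_const measurable_id.abs)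
    have h2 : NullMeasurableSet (⋂ i < k, {ω | |∑ j ∈ Finset.range i, X j ω| ≤ 2 * l}) P :=
      .iInter fun i => .iInter fun _ =>
        (hS _).nullMeasurable (measurableSet_le measurable_id.abs measurable_const)
    convert h1.inter h2 using 1
    ext ω
    simp [A]
  have hBm : ∀ k, NullMeasurableSet (B k) P := fun k =>
    (hS _).nullMeasurable (measurableSet_le measurable_id.abs measurable_const)
  have hB : ∀ k ≤ n, 1 / 2 ≤ P (B k) := by
    intro k hk
    have h1 : P (B k)ᶜ ≤ 1 / 2 := by
      have h := measure_abs_sum_gt_le hind hL hmean hvar (Finset.Ico k n) hl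
      have hc : (B k)ᶜ = {ω | l < |∑ j ∈ Finset.Ico k n, X j ω|} := by
        ext ω
        simp [B]
      rw [hc]
      refine h.trans ?_
      rw [← ENNReal.ofReal_one, ← ENNReal.ofReal_ofNat 2, ← ENNReal.ofReal_div_of_pos two_pos]
      refine ENNReal.ofReal_le_ofReal ?_
      rw [div_le_iff₀ (by positivity)]
      have : ((Finset.Ico k n).card : ℝ) ≤ n := by
        rw [Nat.card_Ico]
        exact_mod_cast Nat.sub_le _ _
      have := mul_le_mul_of_nonneg_right this hv
      linarith
    rw [prob_compl_eq_one_sub₀ (hBm k)] at h1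
    have h2 : (1 : ℝ≥0∞) ≤ 1 / 2 + P (B k) := tsub_le_iff_right.1 h1
    have h3 : (1 : ℝ≥0∞) / 2 + 1 / 2 ≤ 1 / 2 + P (B k) := by
      rwa [ENNReal.add_halves]
    exact (ENNReal.add_le_add_iff_left (by simp)).1 h3
  have hAB : ∀ k ≤ n, P (A k ∩ B k) = P (A k) * P (B k) := by
    intro k hk
    have hi := hind.indepFun_finset₀ (Finset.range k) (Finset.Ico k n)
      (by rw [Finset.disjoint_left]; intro a; simp; omega) hX
    let s : Set (Finset.range k → ℝ) := {x | 2 * l < |∑ j, x j| ∧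
      ∀ i < k, |∑ j : Finset.range k, if (j : ℕ) ∈ Finset.range i then x j else 0| ≤ 2 * l}
    let u : Set (Finset.Ico k n → ℝ) := {x | |∑ j, x j| ≤ l}
    have hs : MeasurableSet s := by
      have h1 : MeasurableSet {x : Finset.range k → ℝ | 2 * l < |∑ j, x j|} :=
        measurableSet_lt measurable_const (Continuous.measurable (by fun_prop))
      have h2 : MeasurableSet (⋂ i < k, {x : Finset.range k → ℝ |
          |∑ j : Finset.range k, if (j : ℕ) ∈ Finset.range i then x j else 0| ≤ 2 * l}) :=
        .iInter fun i => .iInter fun _ =>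
          measurableSet_le (measurable_sum_coe_ite_mem _ _).abs measurable_const
      convert h1.inter h2 using 1
      ext ω
      simp [s]
    have hu : MeasurableSet u :=
      measurableSet_le (Continuous.measurable (by fun_prop)) measurable_const
    have hAs : A k = (fun ω (j : Finset.range k) => X j ω) ⁻¹' s := by
      ext ω
      simp only [A, s, mem_ofPred_eq, mem_preimage]
      rw [Finset.sum_coe_sort (Finset.range k) fun j => X j ω]
      refine and_congr_right fun _ => forall₂_congr fun i hi => ?_
      rw [sum_coe_ite_mem (Finset.range_mono hi.le) fun j => X j ω]
    have hBu : B k = (fun ω (j : Finset.Ico k n) => X j ω) ⁻¹' u := by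
      ext ω
      simp only [B, u, mem_ofPred_eq, mem_preimage]
      rw [Finset.sum_coe_sort (Finset.Ico k n) fun j => X j ω]
    rw [hAs, hBu]
    exact hi.measure_inter_preimage_eq_mul s u hs hu
  have hdisj : Pairwise (Function.onFun Disjoint fun k => A k ∩ B k) := by
    intro i j hij
    wlog h : i < j generalizing i j
    · exact (this hij.symm (by omega)).symm
    rw [Function.onFun, Set.disjoint_left]
    rintro ω ⟨h1, -⟩ ⟨h2, -⟩
    exact absurd (h2.2 i h) (not_le.2 h1.1)
  calc P {ω | ∃ k ≤ n, 2 * l < |∑ j ∈ Finset.range k, X j ω|}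
      ≤ P (⋃ k ∈ Finset.range (n + 1), A k) := by
        refine measure_mono ?_
        rintro ω ⟨k, hk, hω⟩
        classical
        have hex : ∃ k, 2 * l < |∑ j ∈ Finset.range k, X j ω| := ⟨k, hω⟩
        simp only [mem_iUnion]
        refine ⟨Nat.find hex, Finset.mem_range.2 ((Nat.find_min' hex hω).trans_lt (by omega)),
          Nat.find_spec hex, fun i hi => not_lt.1 (Nat.find_min hex hi)⟩
    _ ≤ ∑ k ∈ Finset.range (n + 1), P (A k) := measure_biUnion_finset_le _ _
    _ ≤ ∑ k ∈ Finset.range (n + 1), 2 * P (A k ∩ B k) := by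
        refine Finset.sum_le_sum fun k hk => ?_
        have hk' : k ≤ n := Nat.lt_succ_iff.1 (Finset.mem_range.1 hk)
        rw [hAB k hk', mul_left_comm]
        calc P (A k) = P (A k) * (2 * (1 / 2)) := by
              rw [one_div, ENNReal.mul_inv_cancel two_ne_zero ENNReal.ofNat_ne_top, mul_one]
          _ ≤ _ := by gcongr; exact hB k hk'
    _ = 2 * P (⋃ k ∈ Finset.range (n + 1), A k ∩ B k) := by
        rw [← Finset.mul_sum, measure_biUnion_finset₀ (fun i _ j _ hij => (hdisj hij).aedisjoint)
          fun k _ => (hAm k).inter (hBm k)]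
    _ ≤ _ := by
        gcongr
        intro ω hω
        simp only [mem_iUnion] at hω
        obtain ⟨k, hk, h1, h2⟩ := hω
        have hk' : k ≤ n := Nat.lt_succ_iff.1 (Finset.mem_range.1 hk)
        have h3 := Finset.sum_range_add_sum_Ico (fun j => X j ω) hk'
        have h4 : |∑ j ∈ Finset.range k, X j ω| ≤ |∑ j ∈ Finset.range n, X j ω| +
            |∑ j ∈ Finset.Ico k n, X j ω| := by
          rw [← h3]
          have := abs_sub (∑ j ∈ Finset.range k, X j ω + ∑ j ∈ Finset.Ico k n, X j ω)
            (∑ j ∈ Finset.Ico k n, X j ω)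
          rwa [add_sub_cancel_right] at this
        have h5 : |∑ j ∈ Finset.Ico k n, X j ω| ≤ l := h2
        have h6 := h1.1
        change l < _
        linarith

/-! ### The largest of `T` square-integrable variables -/

theorem tendsto_nat_mul_measure_abs_gt {Y : Ω → ℝ} (hL : MemLp Y 2 P) {δ : ℝ} (hδ : 0 < δ) :
    Tendsto (fun T : ℕ => (T : ℝ≥0∞) * P {ω | δ * √T < |Y ω|}) atTop (𝓝 0) := by
  have hY : AEMeasurable Y P := hL.1.aemeasurable
  let g : ℕ → Ω → ℝ≥0∞ := fun T ω =>
    {ω | δ * √T < |Y ω|}.indicator (fun ω => ENNReal.ofReal (Y ω ^ 2 / δ ^ 2)) ω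
  have hset : ∀ T : ℕ, NullMeasurableSet {ω | δ * √T < |Y ω|} P := fun T =>
    hY.nullMeasurable (measurableSet_lt measurable_const measurable_id.abs)
  have hint : Integrable (fun ω => Y ω ^ 2 / δ ^ 2) P := hL.integrable_sq.div_const _
  have hg : Tendsto (fun T => ∫⁻ ω, g T ω ∂P) atTop (𝓝 0) := by
    have h := tendsto_lintegral_of_dominated_convergence' (μ := P) (F := g) (f := fun _ => 0)
      (fun ω => ENNReal.ofReal (Y ω ^ 2 / δ ^ 2))
      (fun T => (hint.1.aemeasurable.ennreal_ofReal).indicator₀ (hset T))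
      (fun T => ae_of_all _ fun ω => indicator_le_self _ _ _)
      (Integrable.lintegral_lt_top hint).ne ?_
    · simpa using h
    · refine ae_of_all _ fun ω => tendsto_const_nhds.congr' ?_
      have h1 : Tendsto (fun T : ℕ => δ * √T) atTop atTop :=
        (Real.tendsto_sqrt_atTop.comp tendsto_natCast_atTop_atTop).const_mul_atTop hδ
      filter_upwards [h1.eventually_ge_atTop |Y ω|] with T hT
      rw [eq_comm]
      exact indicator_of_notMem (by simpa using hT) _
  refine tendsto_of_tendsto_of_tendsto_of_le_of_le tendsto_const_nhds hg (fun _ => zero_le)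
    fun T => ?_
  calc (T : ℝ≥0∞) * P {ω | δ * √T < |Y ω|}
      = ∫⁻ ω, {ω | δ * √T < |Y ω|}.indicator (fun _ => (T : ℝ≥0∞)) ω ∂P := by
        rw [lintegral_indicator_const₀ (hset T)]
    _ ≤ ∫⁻ ω, g T ω ∂P := by
        refine lintegral_mono fun ω => ?_
        refine indicator_le_indicator' fun hω => ?_
        rw [← ENNReal.ofReal_natCast]
        refine ENNReal.ofReal_le_ofReal ?_
        rw [le_div_iff₀ (by positivity)]
        have h1 : δ * √T < |Y ω| := hω
        have h2 : (δ * √T) ^ 2 ≤ |Y ω| ^ 2 := by gcongr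
        rw [mul_pow, Real.sq_sqrt T.cast_nonneg, sq_abs] at h2
        linarith

/-- For identically distributed square-integrable variables, the maximum of `T` of them is of
smaller order than `√T`. -/
theorem tendsto_measure_exists_abs_gt {Y : ℕ → Ω → ℝ}
    (hid : ∀ t, IdentDistrib (Y t) (Y 0) P P) (hL : MemLp (Y 0) 2 P) {δ : ℝ} (hδ : 0 < δ) :
    Tendsto (fun T : ℕ => P {ω | ∃ t < T, δ * √T < |Y t ω|}) atTop (𝓝 0) := by
  refine tendsto_of_tendsto_of_tendsto_of_le_of_le tendsto_const_nhds
    (tendsto_nat_mul_measure_abs_gt hL hδ) (fun _ => zero_le) fun T => ?_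
  calc P {ω | ∃ t < T, δ * √T < |Y t ω|}
      ≤ P (⋃ t ∈ Finset.range T, Y t ⁻¹' {x | δ * √T < |x|}) := by
        refine measure_mono ?_
        rintro ω ⟨t, ht, hω⟩
        simp only [mem_iUnion]
        exact ⟨t, Finset.mem_range.2 ht, hω⟩
    _ ≤ ∑ t ∈ Finset.range T, P (Y t ⁻¹' {x | δ * √T < |x|}) := measure_biUnion_finset_le _ _
    _ = T * P (Y 0 ⁻¹' {x | δ * √T < |x|}) := by
        have hs : MeasurableSet {x : ℝ | δ * √T < |x|} :=
          measurableSet_lt measurable_const measurable_id.abs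
        rw [Finset.sum_congr rfl fun t _ => (hid t).measure_mem_eq hs]
        simp

end Maximal

/-! ### Joint central limit theorem for block sums -/

/-- Convergence in distribution only depends on the laws. -/
theorem MeasureTheory.TendstoInDistribution.of_map_eq {E Ω₁ Ω₂ Ω₃ Ω₄ : Type*} [MeasurableSpace E]
    [TopologicalSpace E] [OpensMeasurableSpace E] [MeasurableSpace Ω₁] [MeasurableSpace Ω₂]
    [MeasurableSpace Ω₃] [MeasurableSpace Ω₄] {P₁ : Measure Ω₁} [IsProbabilityMeasure P₁]
    {P₂ : Measure Ω₂} [IsProbabilityMeasure P₂] {Q₁ : Measure Ω₃} [IsProbabilityMeasure Q₁]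
    {Q₂ : Measure Ω₄} [IsProbabilityMeasure Q₂] {X : ℕ → Ω₁ → E} {X' : ℕ → Ω₂ → E} {Z : Ω₃ → E}
    {Z' : Ω₄ → E} (h : TendstoInDistribution X atTop Z (fun _ => P₁) Q₁)
    (hX' : ∀ n, AEMeasurable (X' n) P₂) (hZ' : AEMeasurable Z' Q₂)
    (hX : ∀ n, P₂.map (X' n) = P₁.map (X n)) (hZ : Q₂.map Z' = Q₁.map Z) :
    TendstoInDistribution X' atTop Z' (fun _ => P₂) Q₂ := by
  refine ⟨hX', hZ', ?_⟩
  have h1 : (⟨Q₂.map Z', Measure.isProbabilityMeasure_map hZ'⟩ : ProbabilityMeasure E) =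
      ⟨Q₁.map Z, Measure.isProbabilityMeasure_map h.aemeasurable_limit⟩ := Subtype.ext hZ
  rw [h1]
  exact h.tendsto.congr fun n => Subtype.ext (hX n).symm

section Blocks

variable {Ω : Type*} [MeasurableSpace Ω] {P : Measure Ω} [IsProbabilityMeasure P]
  {X : ℕ → Ω → ℝ}

/-- Sums of independent variables over successive blocks are independent. -/
theorem iIndepFun_sum_Ico (hind : iIndepFun X P) (hX : ∀ j, AEMeasurable (X j) P) {k : ℕ → ℕ}
    (hk : Monotone k) :
    iIndepFun (fun (i : ℕ) ω => ∑ j ∈ Finset.Ico (k i) (k (i + 1)), X j ω) P := by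
  rw [iIndepFun_iff_measure_inter_preimage_eq_mul]
  intro S
  induction S using Finset.induction_on_max with
  | empty => simp
  | insert a S ha ih =>
    intro s hs
    have haS : a ∉ S := fun h => lt_irrefl a (ha a h)
    rw [Finset.prod_insert haS, ← ih fun i hi => hs i (Finset.mem_insert_of_mem hi),
      Finset.set_biInter_insert]
    have hi := hind.indepFun_finset₀ (Finset.Ico (k a) (k (a + 1))) (Finset.range (k a))
      (by rw [Finset.disjoint_left]; intro a; simp; omega) hX
    let u : Set (Finset.range (k a) → ℝ) := ⋂ i ∈ S, (fun x => ∑ j : Finset.range (k a),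
      if (j : ℕ) ∈ Finset.Ico (k i) (k (i + 1)) then x j else 0) ⁻¹' s i
    have hu : MeasurableSet u := Finset.measurableSet_biInter _ fun i hi =>
      measurable_sum_coe_ite_mem _ _ (hs i (Finset.mem_insert_of_mem hi))
    let v : Set (Finset.Ico (k a) (k (a + 1)) → ℝ) := (fun x => ∑ j, x j) ⁻¹' s a
    have hv : MeasurableSet v :=
      (Continuous.measurable (by fun_prop)) (hs a (Finset.mem_insert_self a S))
    have h1 : (fun ω => ∑ j ∈ Finset.Ico (k a) (k (a + 1)), X j ω) ⁻¹' s a =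
        (fun ω (j : Finset.Ico (k a) (k (a + 1))) => X j ω) ⁻¹' v := by
      ext ω
      simp only [v, mem_preimage]
      rw [Finset.sum_coe_sort (Finset.Ico (k a) (k (a + 1))) fun j => X j ω]
    have h2 : ⋂ i ∈ S, (fun ω => ∑ j ∈ Finset.Ico (k i) (k (i + 1)), X j ω) ⁻¹' s i =
        (fun ω (j : Finset.range (k a)) => X j ω) ⁻¹' u := by
      ext ω
      simp only [u, mem_iInter, mem_preimage]
      refine forall₂_congr fun i hi => ?_
      have hsub : Finset.Ico (k i) (k (i + 1)) ⊆ Finset.range (k a) := by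
        intro j hj
        have : k (i + 1) ≤ k a := hk (ha i hi)
        rw [Finset.mem_Ico] at hj
        rw [Finset.mem_range]
        omega
      rw [sum_coe_ite_mem hsub fun j => X j ω]
    rw [h1, h2]
    exact hi.measure_inter_preimage_eq_mul v u hv hu

/-- The law of a sum of independent identically distributed variables depends on the number of
terms only. -/
theorem map_sum_eq_map_sum_range (hind : iIndepFun X P)
    (hid : ∀ j, IdentDistrib (X j) (X 0) P P) (s : Finset ℕ) :
    P.map (fun ω => ∑ j ∈ s, X j ω) = P.map (fun ω => ∑ j ∈ Finset.range s.card, X j ω) := by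
  have hX : ∀ j, AEMeasurable (X j) P := fun j => (hid j).aemeasurable_fst
  have hP : ∀ s : Finset ℕ, IsProbabilityMeasure (P.map (fun ω => ∑ j ∈ s, X j ω)) := fun s =>
    Measure.isProbabilityMeasure_map (Finset.aemeasurable_fun_sum s fun j _ => hX j)
  have := hP s
  have := hP (Finset.range s.card)
  refine Measure.ext_of_charFun ?_
  have key : ∀ s : Finset ℕ, charFun (P.map (fun ω => ∑ j ∈ s, X j ω)) =
      charFun (P.map (X 0)) ^ s.card := fun s => by
    rw [(hind.restrict _).charFun_map_fun_finsetSum_eq_prod fun j _ => hX j,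
      Finset.prod_congr rfl fun j _ => by rw [(hid j).map_eq], Finset.prod_const]
  rw [key, key, Finset.card_range]

/-- The central limit theorem for sums over blocks of length asymptotic to `τ T`. -/
theorem tendstoInDistribution_block (hind : iIndepFun X P)
    (hid : ∀ j, IdentDistrib (X j) (X 0) P P) (hL : MemLp (X 0) 2 P)
    (hmean : ∫ ω, X 0 ω ∂P = 0) {σ : ℝ} (hσ : 0 < σ) (hvar : Var[X 0; P] = σ ^ 2) {τ : ℝ≥0}
    (hτ : 0 < τ) {a b : ℕ → ℕ}
    (hab : Tendsto (fun T : ℕ => ((b T - a T : ℕ) : ℝ) / T) atTop (𝓝 τ)) :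
    TendstoInDistribution
      (fun (T : ℕ) ω => (∑ j ∈ Finset.Ico (a T) (b T), X j ω) / (σ * √T)) atTop id
      (fun _ => P) (gaussianReal 0 τ) := by
  have hX : ∀ j, AEMeasurable (X j) P := fun j => (hid j).aemeasurable_fst
  have hS : ∀ s : Finset ℕ, AEMeasurable (fun ω => ∑ j ∈ s, X j ω) P :=
    fun s => Finset.aemeasurable_fun_sum s fun j _ => hX j
  have hn : Tendsto (fun T => b T - a T) atTop atTop := by
    have h1 : Tendsto (fun T : ℕ => ((b T - a T : ℕ) : ℝ) / T * T) atTop atTop :=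
      Tendsto.pos_mul_atTop (by exact_mod_cast hτ) hab tendsto_natCast_atTop_atTop
    refine tendsto_natCast_atTop_iff (R := ℝ) |>.1 (h1.congr' ?_)
    filter_upwards [eventually_gt_atTop 0] with T hT
    have : (T : ℝ) ≠ 0 := by positivity
    field_simp
  have hc : Tendsto (fun T : ℕ => √((b T - a T : ℕ) : ℝ) / (σ * √T)) atTop (𝓝 (√τ / σ)) := by
    refine (((Real.continuous_sqrt.tendsto _).comp hab).div_const σ).congr fun T => ?_
    simp only [Function.comp_apply]
    rw [Real.sqrt_div (Nat.cast_nonneg _), div_div, mul_comm]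
  have hlaw : HasLaw (id : ℝ → ℝ) (gaussianReal 0 Var[X 0; P].toNNReal)
      (gaussianReal 0 Var[X 0; P].toNNReal) := HasLaw.id
  have hclt := tendstoInDistribution_inv_sqrt_mul_sum_sub hlaw hL hind hid
  have hclt' : TendstoInDistribution (fun (T : ℕ) ω => (√((b T - a T : ℕ) : ℝ))⁻¹ *
      (∑ j ∈ Finset.range (b T - a T), X j ω - ((b T - a T : ℕ) : ℝ) * ∫ ω, X 0 ω ∂P)) atTop id
      (fun _ => P) (gaussianReal 0 Var[X 0; P].toNNReal) :=
    ⟨fun T => hclt.forall_aemeasurable _, hclt.aemeasurable_limit, hclt.tendsto.comp hn⟩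
  have hsl := hclt'.continuous_comp_prodMk_of_tendstoInMeasure_const
    (Y := fun (T : ℕ) (_ : Ω) => √((b T - a T : ℕ) : ℝ) / (σ * √T)) (c := √τ / σ)
    (g := fun p : ℝ × ℝ => p.2 * p.1) (by fun_prop)
    (tendstoInMeasure_of_tendsto_ae (fun T => aestronglyMeasurable_const)
      (ae_of_all _ fun _ => hc)) (fun T => aemeasurable_const)
  refine hsl.of_map_eq (fun T => (hS _).div_const _) aemeasurable_id (fun T => ?_) ?_
  · -- place the block at the start of the sequence
    have h1 : (fun ω => (∑ j ∈ Finset.Ico (a T) (b T), X j ω) / (σ * √T)) =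
        (fun x => x / (σ * √T)) ∘ fun ω => ∑ j ∈ Finset.Ico (a T) (b T), X j ω := rfl
    rw [h1, ← AEMeasurable.map_map_of_aemeasurable (by fun_prop) (hS _),
      map_sum_eq_map_sum_range hind hid, AEMeasurable.map_map_of_aemeasurable (by fun_prop) (hS _),
      Nat.card_Ico]
    congr 1
    ext ω
    simp only [Function.comp_apply, hmean, mul_zero, sub_zero]
    rcases Nat.eq_zero_or_pos (b T - a T) with h0 | h0
    · simp [h0]
    · have : √((b T - a T : ℕ) : ℝ) ≠ 0 := by positivity
      field_simp
  · change (gaussianReal 0 τ).map id = (gaussianReal 0 Var[X 0; P].toNNReal).map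
      (fun ω => √τ / σ * id ω)
    rw [Measure.map_id]
    simp only [id]
    rw [gaussianReal_map_const_mul, mul_zero, hvar]
    congr 1
    ext
    simp only [NNReal.coe_mul, NNReal.coe_mk, div_pow, Real.sq_sqrt τ.coe_nonneg,
      Real.coe_toNNReal _ (sq_nonneg σ)]
    field_simp

end Blocks

/-- Convergence in law of the coordinates gives joint convergence when the coordinates are
independent. -/
theorem tendstoInDistribution_pi {Ω Ω' ι : Type*} [Fintype ι] [MeasurableSpace Ω]
    [MeasurableSpace Ω'] {P : Measure Ω} [IsProbabilityMeasure P] {Q : Measure Ω'}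
    [IsProbabilityMeasure Q] {Y : ℕ → ι → Ω → ℝ} {Z : ι → Ω' → ℝ}
    (hY : ∀ n, iIndepFun (Y n) P) (hZ : iIndepFun Z Q)
    (h : ∀ i, TendstoInDistribution (fun n => Y n i) atTop (Z i) (fun _ => P) Q) :
    TendstoInDistribution (fun n ω i => Y n i ω) atTop (fun ω i => Z i ω) (fun _ => P) Q := by
  refine ⟨fun n => aemeasurable_pi_lambda _ fun i => (h i).forall_aemeasurable n,
    aemeasurable_pi_lambda _ fun i => (h i).aemeasurable_limit, ?_⟩
  have hpi := (ProbabilityMeasure.continuous_pi (α := fun _ : ι => ℝ)).continuousAt.tendsto.comp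
    (tendsto_pi_nhds.2 fun i => (h i).tendsto)
  have hZpi := (iIndepFun_iff_map_fun_eq_pi_map fun i => (h i).aemeasurable_limit).1 hZ
  have hYpi : ∀ n, P.map (fun ω i => Y n i ω) = Measure.pi fun i => P.map (Y n i) := fun n =>
    (iIndepFun_iff_map_fun_eq_pi_map fun i => (h i).forall_aemeasurable n).1 (hY n)
  have e : (⟨Q.map (fun ω i => Z i ω), Measure.isProbabilityMeasure_map
      (aemeasurable_pi_lambda _ fun i => (h i).aemeasurable_limit)⟩ :
      ProbabilityMeasure (ι → ℝ)) = ProbabilityMeasure.pi fun i =>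
        ⟨Q.map (Z i), Measure.isProbabilityMeasure_map (h i).aemeasurable_limit⟩ :=
    Subtype.ext hZpi
  rw [e]
  exact hpi.congr fun n => Subtype.ext (hYpi n).symm

/-! ### The polygonal approximation of the random walk -/

/-- The index at which the `i`-th of `m` blocks of `{0, …, T}` begins. -/
def knot (m T i : ℕ) : ℕ := i * T / m

theorem monotone_knot (m T : ℕ) : Monotone (knot m T) := fun _ _ h =>
  Nat.div_le_div_right (Nat.mul_le_mul_right T h)

theorem knot_zero (m T : ℕ) : knot m T 0 = 0 := by simp [knot]

theorem knot_succ_sub_knot_le {m : ℕ} (hm : 0 < m) (T i : ℕ) :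
    knot m T (i + 1) - knot m T i ≤ T / m + 1 := by
  have h : knot m T (i + 1) ≤ i * T / m + T / m + 1 := by
    unfold knot
    rw [add_mul, one_mul, Nat.add_div hm]
    split_ifs <;> omega
  exact Nat.sub_le_iff_le_add'.2 (h.trans_eq (add_assoc _ _ _))

theorem tendsto_knot_sub_div {m : ℕ} (hm : 0 < m) (i : ℕ) :
    Tendsto (fun T : ℕ => ((knot m T (i + 1) - knot m T i : ℕ) : ℝ) / T) atTop
      (𝓝 (((m : ℝ≥0)⁻¹ : ℝ≥0) : ℝ)) := by
  have hfl : ∀ T i : ℕ, knot m T i = ⌊(i / m : ℝ) * T⌋₊ := by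
    intro T i
    rw [div_mul_eq_mul_div, ← Nat.cast_mul, Nat.floor_div_eq_div, knot]
  have hlim : ∀ i : ℕ, Tendsto (fun T : ℕ => (knot m T i : ℝ) / T) atTop (𝓝 (i / m : ℝ)) := by
    intro i
    simp_rw [hfl]
    exact (tendsto_nat_floor_mul_div_atTop (R := ℝ) (a := i / m) (by positivity)).comp
      tendsto_natCast_atTop_atTop
  have h := (hlim (i + 1)).sub (hlim i)
  have e : (((i + 1 : ℕ) : ℝ) / m - i / m) = (((m : ℝ≥0)⁻¹ : ℝ≥0) : ℝ) := by
    push_cast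
    ring
  rw [e] at h
  refine h.congr fun T => ?_
  rw [Nat.cast_sub (monotone_knot m T (Nat.le_succ i)), sub_div]

/-- The sums of `X` over the `m` blocks of `{0, …, T - 1}`, normalized as in Donsker's theorem. -/
noncomputable def blockSum (m T : ℕ) (σ : ℝ) (X : ℕ → ℝ) (i : ℕ) : ℝ :=
  (∑ j ∈ Finset.Ico (knot m T i) (knot m T (i + 1)), X j) / (σ * √T)

/-- Within each of the `m` blocks, the normalized partial sums stay within `o` of their value at
the beginning of the block. -/
def BlockOscLE (m T : ℕ) (σ : ℝ) (X : ℕ → ℝ) (o : ℝ) : Prop :=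
  ∀ i < m, ∀ k, knot m T i ≤ k → k ≤ knot m T (i + 1) →
    |(∑ j ∈ Finset.Ico (knot m T i) k, X j) / (σ * √T)| ≤ o

theorem scaledWalk_eq_sum_range (η : ℕ → ℝ) (σ : ℝ) (T t : ℕ) :
    scaledWalk η σ T t = (∑ j ∈ Finset.range t, η (j + 1)) / (σ * √T) := by
  rw [scaledWalk, Finset.range_eq_Ico, Finset.sum_Ico_add' η 0 t 1]
  rfl

theorem scaledWalk_sub {η : ℕ → ℝ} {σ : ℝ} {T s t : ℕ} (hst : s ≤ t) :
    scaledWalk η σ T t - scaledWalk η σ T s =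
      (∑ j ∈ Finset.Ico s t, η (j + 1)) / (σ * √T) := by
  rw [scaledWalk_eq_sum_range, scaledWalk_eq_sum_range, ← sub_div,
    ← Finset.sum_range_add_sum_Ico _ hst, add_sub_cancel_left]

/-- When the blocks oscillate little, the polygon through the block sums is slowly varying and
follows the random walk. -/
theorem BlockOscLE.polygon {η : ℕ → ℝ} {σ o : ℝ} {m T : ℕ} (hm : 0 < m) (hmT : m ≤ T)
    (h : BlockOscLE m T σ (fun j => η (j + 1)) o) :
    SlowlyVarying (polygon m fun i => blockSum m T σ (fun j => η (j + 1)) i) (2 * o) T ∧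
    ∀ t ≤ T, |scaledWalk η σ T t -
      polygon m (fun i => blockSum m T σ (fun j => η (j + 1)) i) (t / T)| ≤ 2 * o := by
  have hm' : (0 : ℝ) < m := by exact_mod_cast hm
  have hmT' : (m : ℝ) ≤ T := by exact_mod_cast hmT
  have hT' : (0 : ℝ) < T := hm'.trans_le hmT'
  set v : ℕ → ℝ := fun i => scaledWalk η σ T (knot m T i) with hv
  have hb : (fun i : Fin m => blockSum m T σ (fun j => η (j + 1)) i) =
      fun i : Fin m => v (i + 1) - v i := by
    ext i
    rw [hv]
    exact (scaledWalk_sub (monotone_knot m T (Nat.le_succ i))).symm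
  have hv0 : v 0 = 0 := by simp [hv, knot_zero, scaledWalk]
  have hinc : ∀ i < m, |v (i + 1) - v i| ≤ o := fun i hi => by
    have := h i hi (knot m T (i + 1)) (monotone_knot m T (Nat.le_succ i)) le_rfl
    rwa [← scaledWalk_sub (monotone_knot m T (Nat.le_succ i))] at this
  have ho : 0 ≤ o := (abs_nonneg _).trans (hinc 0 hm)
  have hinc' : ∀ i : Fin m, |v (i + 1) - v i| ≤ o := fun i => hinc i i.2
  rw [hb]
  refine ⟨⟨continuous_polygon _ _, fun x hx => ?_, fun x _ y _ hxy => ?_⟩, fun t ht => ?_⟩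
  · calc _ ≤ o * m := abs_polygon_le hinc' hx
      _ ≤ o * T := by gcongr
      _ ≤ 2 * o * T := by nlinarith
  · calc _ ≤ o * (m * |x - y|) := abs_polygon_sub_le hinc' x y
      _ ≤ o * (T * (1 / T)) := by gcongr
      _ = o := by field_simp
      _ ≤ 2 * o := by linarith
  · -- the block that contains `t`
    set i := m * t / T with hi
    have h1 : i * T ≤ m * t := Nat.div_mul_le_self _ _
    have h2 : m * t < (i + 1) * T := by
      have := Nat.lt_div_mul_add (a := m * t) (b := T) (hm.trans_le hmT)
      rw [add_mul, one_mul]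
      exact this
    have him : i ≤ m := Nat.div_le_of_le_mul (by rw [mul_comm]; gcongr)
    have hk1 : knot m T i ≤ t := Nat.div_le_of_le_mul h1
    have hx : |(t : ℝ) / T - i / m| ≤ 1 / m := by
      have h1' : (i : ℝ) * T ≤ m * t := by exact_mod_cast h1
      have h2' : (m : ℝ) * t < (i + 1) * T := by exact_mod_cast h2
      rw [abs_of_nonneg (sub_nonneg.2 (by rw [div_le_div_iff₀ hm' hT']; linarith)),
        sub_le_iff_le_add, ← add_div, div_le_div_iff₀ hT' hm']
      linarith
    refine abs_sub_polygon_le hm hv0 hinc him hx ?_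
    rw [hv, scaledWalk_sub hk1]
    rcases him.lt_or_eq with him | him
    · refine h i him t hk1 ?_
      rw [knot, Nat.le_div_iff_mul_le hm]
      linarith
    · have : t ≤ knot m T i := by
        rw [him, knot, Nat.mul_div_cancel_left _ hm]
        exact ht
      rw [Finset.Ico_eq_empty_of_le this]
      simpa using ho

/-- The path of the normalized residuals is uniformly close to the image of the polygonal
approximation of the random walk under integration and detrending. -/
theorem exists_abs_step_sub_detrended_le (r k : ℕ) : ∃ C ≥ (0 : ℝ), ∃ T₀ : ℕ, ∀ T ≥ T₀,
    ∀ m : ℕ, 0 < m → m ≤ T → ∀ (η ε : ℕ → ℝ) (σ : ℝ), 0 < σ → ∀ α a : Fin (r + 1) → ℝ,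
    IsLeastSquares T (trendSeries α (k + 1) η ε T) a → ∀ o e : ℝ,
    BlockOscLE m T σ (fun j => η (j + 1)) o → (∀ t ≤ T, |ε t| ≤ e * (σ * √T)) →
    ∀ x ∈ Icc (0 : ℝ) 1, |trendResidual T (trendSeries α (k + 1) η ε T) a ⌊T * x⌋₊ /
        (σ * (T : ℝ) ^ (((k + 1 : ℕ) : ℝ) - 1 / 2)) -
      detrended r k (polygon m fun i => blockSum m T σ (fun j => η (j + 1)) i) x| ≤
      C * (o + e) := by
  obtain ⟨C, hC, T₀, h⟩ := exists_abs_residual_sub_le r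
  refine ⟨C * (2 * (k + 1) + 2), by positivity, T₀, ?_⟩
  intro T hTT m hm hmT η ε σ hσ α a ha o e ho he x hx
  have hT : 0 < T := hm.trans_le hmT
  have hT' : (0 : ℝ) < T := by exact_mod_cast hT
  obtain ⟨hf, hw⟩ := ho.polygon hm hmT
  set f := _root_.polygon m fun i => blockSum m T σ (fun j => η (j + 1)) i with hfd
  have hF := hf.iteratedPrimitive hT k
  have hW := abs_integratedWalk_sub_iteratedPrimitive_le hT hf hw k
  rw [rpow_scale hT]
  set s : ℝ := σ * ((T : ℝ) ^ k * √T) with hs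
  have hs0 : 0 < s := by positivity
  have hss : σ * √T ≤ s := by
    have : (1 : ℝ) ≤ (T : ℝ) ^ k := one_le_pow₀ (by exact_mod_cast hT)
    rw [hs]
    gcongr
    exact le_mul_of_one_le_left (Real.sqrt_nonneg _) this
  have he0 : 0 ≤ e := by
    have h1 := (abs_nonneg _).trans (he 0 (Nat.zero_le _))
    exact nonneg_of_mul_nonneg_left h1 (by positivity)
  have ho0 : 0 ≤ o := by have := hf.nonneg; linarith
  set w : ℕ → ℝ := fun t => (integratedWalk η (k + 1) t + ε t) / s with hwd
  set β : Fin (r + 1) → ℝ := fun i => (a i - α i) / s with hβ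
  have hres : ∀ t, trendResidual T (trendSeries α (k + 1) η ε T) a t / s =
      w t - polyTrend β (t / T) := by
    intro t
    have h1 : polyTrend β (t / T) = (polyTrend a (t / T) - polyTrend α (t / T)) / s := by
      simp only [polyTrend, hβ, ← Finset.sum_sub_distrib, Finset.sum_div]
      refine Finset.sum_congr rfl fun i _ => ?_
      ring
    rw [h1, hwd, trendResidual, trendSeries]
    ring
  have hnormal : ∀ j : Fin (r + 1),
      ∑ t ∈ Finset.Icc 1 T, (w t - polyTrend β (t / T)) * ((t : ℝ) / T) ^ (j : ℕ) = 0 := by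
    intro j
    simp_rw [← hres, div_mul_eq_mul_div]
    rw [← Finset.sum_div, ha.normal_equations j, zero_div]
  have hwF : ∀ t ≤ T, |w t - iteratedPrimitive f k (t / T)| ≤ (k + 1) * (2 * o) + e := by
    intro t ht
    have h1 : |ε t / s| ≤ e := by
      rw [abs_div, abs_of_pos hs0, div_le_iff₀ hs0]
      exact (he t ht).trans (by gcongr)
    calc _ = |(integratedWalk η (k + 1) t / s - iteratedPrimitive f k (t / T)) + ε t / s| := by
          rw [hwd]; congr 1; ring
      _ ≤ _ := (abs_add_le _ _).trans (add_le_add (hW t ht) h1)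
  rw [hres, detrended_eq]
  refine (h T hTT hT _ _ _ hF w hwF β hnormal x hx).trans ?_
  rw [mul_assoc]
  gcongr
  have hk : (0 : ℝ) ≤ k := k.cast_nonneg
  nlinarith [mul_nonneg hk he0]

/-! ### Oscillation within blocks -/

theorem tendsto_nat_mul_gaussianReal_abs_ge {δ : ℝ} (hδ : 0 < δ) :
    Tendsto (fun m : ℕ => (m : ℝ≥0∞) * gaussianReal 0 (m : ℝ≥0)⁻¹ {x | δ ≤ |x|}) atTop (𝓝 0) := by
  have h := tendsto_nat_mul_measure_abs_gt (P := gaussianReal 0 1) (Y := id)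
    (memLp_id_gaussianReal 2) (half_pos hδ)
  refine tendsto_of_tendsto_of_tendsto_of_le_of_le' tendsto_const_nhds h
    (Eventually.of_forall fun _ => zero_le) ?_
  filter_upwards [eventually_gt_atTop 0] with m hm
  have hm' : (0 : ℝ) < m := by exact_mod_cast hm
  have hmap : gaussianReal 0 (m : ℝ≥0)⁻¹ = (gaussianReal 0 1).map ((√m)⁻¹ * ·) := by
    rw [gaussianReal_map_const_mul, mul_zero, mul_one]
    congr 1
    ext
    simp
  have hs : MeasurableSet {x : ℝ | δ ≤ |x|} := measurableSet_le measurable_const measurable_id.abs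
  rw [hmap, Measure.map_apply (by fun_prop) hs]
  gcongr
  intro x hx
  have hx' : δ ≤ |(√m)⁻¹ * x| := hx
  have hsm : 0 < √(m : ℝ) := by positivity
  rw [abs_mul, abs_of_pos (inv_pos.2 hsm), le_inv_mul_iff₀ hsm] at hx'
  change δ / 2 * √m < |x|
  nlinarith [mul_pos hδ hsm]

section Osc

variable {Ω : Type*} [MeasurableSpace Ω] {P : Measure Ω} [IsProbabilityMeasure P]
  {X : ℕ → Ω → ℝ} {σ : ℝ}

theorem IsWhiteNoise.tendstoInDistribution_blockSum (hX : IsWhiteNoise X σ P) (hσ : 0 < σ) {m : ℕ}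
    (hm : 0 < m) (i : ℕ) :
    TendstoInDistribution (fun (T : ℕ) ω => blockSum m T σ (fun j => X j ω) i) atTop id
      (fun _ => P) (gaussianReal 0 (m : ℝ≥0)⁻¹) :=
  tendstoInDistribution_block hX.indep hX.identDistrib (hX.memLp 0) (hX.mean 0) hσ
    (hX.variance 0) (by positivity) (tendsto_knot_sub_div hm i)

/-- The probability that some block oscillates by more than `2 δ` is small for fine partitions:
by Ottaviani's inequality it is controlled by the block sums, which are nearly Gaussian with
variance `1 / m`. -/
theorem IsWhiteNoise.eventually_measure_not_blockOscLE_le (hX : IsWhiteNoise X σ P) (hσ : 0 < σ)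
    {δ θ : ℝ} (hδ : 0 < δ) (hθ : 0 < θ) :
    ∀ᶠ m : ℕ in atTop, ∀ᶠ T : ℕ in atTop,
      P {ω | ¬ BlockOscLE m T σ (fun j => X j ω) (2 * δ)} ≤ ENNReal.ofReal θ := by
  have hg := (tendsto_nat_mul_gaussianReal_abs_ge hδ).eventually
    (gt_mem_nhds (ENNReal.ofReal_pos.2 (half_pos hθ)))
  filter_upwards [hg, eventually_gt_atTop 0, eventually_ge_atTop ⌈4 / δ ^ 2⌉₊] with m hgm hm hmδ
  have hm' : (0 : ℝ) < m := by exact_mod_cast hm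
  have hmδ' : 4 / δ ^ 2 ≤ m := (Nat.le_ceil _).trans (by exact_mod_cast hmδ)
  have hgm' : gaussianReal 0 (m : ℝ≥0)⁻¹ {x | δ ≤ |x|} < ENNReal.ofReal (θ / (2 * m)) := by
    have h1 : ENNReal.ofReal (θ / (2 * m)) = ENNReal.ofReal (θ / 2) / m := by
      rw [← ENNReal.ofReal_natCast m, ← ENNReal.ofReal_div_of_pos hm', div_div]
    rw [h1, ENNReal.lt_div_iff_mul_lt (Or.inl (by exact_mod_cast hm.ne'))
      (Or.inl (ENNReal.natCast_ne_top m)), mul_comm]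
    exact hgm
  -- each block sum exceeds `δ` with probability at most `θ / (2 m)`
  have hblock : ∀ i : ℕ, ∀ᶠ T : ℕ in atTop,
      P {ω | δ < |blockSum m T σ (fun j => X j ω) i|} ≤ ENNReal.ofReal (θ / (2 * m)) := by
    intro i
    have hc := hX.tendstoInDistribution_blockSum hσ hm i
    have hcl : IsClosed {x : ℝ | δ ≤ |x|} := isClosed_le continuous_const continuous_abs
    have h1 := ProbabilityMeasure.limsup_measure_closed_le_of_tendsto hc.tendsto hcl
    change limsup (fun T : ℕ => P.map (fun ω => blockSum m T σ (fun j => X j ω) i) _) atTop ≤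
      (gaussianReal 0 (m : ℝ≥0)⁻¹).map id _ at h1
    rw [Measure.map_id] at h1
    filter_upwards [eventually_lt_of_limsup_lt (h1.trans_lt hgm')] with T hT
    rw [Measure.map_apply_of_aemeasurable (hc.forall_aemeasurable T) hcl.measurableSet] at hT
    refine (measure_mono fun ω hω => ?_).trans hT.le
    have hω' : δ < |blockSum m T σ (fun j => X j ω) i| := hω
    exact hω'.le
  have hblocks : ∀ᶠ T : ℕ in atTop, ∀ i ∈ Finset.range m,
      P {ω | δ < |blockSum m T σ (fun j => X j ω) i|} ≤ ENNReal.ofReal (θ / (2 * m)) :=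
    (eventually_all_finset _).2 fun i _ => hblock i
  filter_upwards [hblocks, eventually_ge_atTop m] with T hT hmT
  have hmT' : (m : ℝ) ≤ T := by exact_mod_cast hmT
  have hT' : (0 : ℝ) < T := hm'.trans_le hmT'
  have hs : 0 < σ * √(T : ℝ) := by positivity
  have hmax : ∀ i, P {ω | ∃ k, knot m T i ≤ k ∧ k ≤ knot m T (i + 1) ∧
      2 * δ < |(∑ j ∈ Finset.Ico (knot m T i) k, X j ω) / (σ * √T)|} ≤
      2 * P {ω | δ < |blockSum m T σ (fun j => X j ω) i|} := by
    intro i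
    set p := knot m T i with hp
    set n := knot m T (i + 1) - p with hn
    have hpn : p ≤ knot m T (i + 1) := monotone_knot m T (Nat.le_succ i)
    have hnle : (n : ℝ) ≤ 2 * (T / m) := by
      have h1 : (n : ℝ) ≤ (T / m : ℕ) + 1 := by exact_mod_cast knot_succ_sub_knot_le hm T i
      have h2 : ((T / m : ℕ) : ℝ) ≤ T / m := Nat.cast_div_le
      have h3 : 1 ≤ (T : ℝ) / m := (one_le_div hm').2 hmT'
      linarith
    have hvar : n * σ ^ 2 ≤ (δ * (σ * √T)) ^ 2 / 2 := by
      have h1 : (T : ℝ) / m ≤ T * (δ ^ 2 / 4) := by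
        rw [div_le_iff₀ (by positivity)] at hmδ'
        rw [div_le_iff₀ hm']
        nlinarith
      calc n * σ ^ 2 ≤ 2 * (T * (δ ^ 2 / 4)) * σ ^ 2 := by gcongr; linarith
        _ = δ ^ 2 * (σ ^ 2 * T) / 2 := by ring
        _ = (δ * (σ * √T)) ^ 2 / 2 := by
          rw [mul_pow, mul_pow, Real.sq_sqrt hT'.le]
    have hsum : ∀ k ω, ∑ j ∈ Finset.range k, X (p + j) ω =
        ∑ j ∈ Finset.Ico p (p + k), X j ω := fun k ω => by
      rw [Finset.sum_Ico_eq_sum_range, add_tsub_cancel_left]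
    have hO := measure_max_abs_sum_gt_le (X := fun j => X (p + j))
      (hX.indep.precomp (add_right_injective p)) (fun j => hX.memLp _) (fun j => hX.mean _)
      (sq_nonneg σ) (fun j => hX.variance _) (mul_pos hδ hs) hvar
    simp_rw [hsum] at hO
    have hpn' : p + n = knot m T (i + 1) := by omega
    rw [hpn'] at hO
    refine le_trans (measure_mono ?_) (hO.trans_eq ?_)
    · rintro ω ⟨k, hk1, hk2, hω⟩
      refine ⟨k - p, by omega, ?_⟩
      rw [add_tsub_cancel_of_le hk1]
      rw [abs_div, abs_of_pos hs, lt_div_iff₀ hs, mul_assoc] at hω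
      exact hω
    · congr 2
      ext ω
      simp only [mem_ofPred_eq, blockSum]
      rw [abs_div, abs_of_pos hs, lt_div_iff₀ hs]
  calc P {ω | ¬ BlockOscLE m T σ (fun j => X j ω) (2 * δ)}
      ≤ P (⋃ i ∈ Finset.range m, {ω | ∃ k, knot m T i ≤ k ∧ k ≤ knot m T (i + 1) ∧
          2 * δ < |(∑ j ∈ Finset.Ico (knot m T i) k, X j ω) / (σ * √T)|}) := by
        refine measure_mono fun ω hω => ?_
        simp only [BlockOscLE, mem_ofPred_eq, not_forall, not_le] at hω
        obtain ⟨i, hi, k, hk1, hk2, h⟩ := hω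
        simp only [mem_iUnion]
        exact ⟨i, Finset.mem_range.2 hi, k, hk1, hk2, h⟩
    _ ≤ ∑ i ∈ Finset.range m, _ := measure_biUnion_finset_le _ _
    _ ≤ ∑ _i ∈ Finset.range m, 2 * ENNReal.ofReal (θ / (2 * m)) :=
        Finset.sum_le_sum fun i hi => (hmax i).trans (by gcongr; exact hT i hi)
    _ = ENNReal.ofReal θ := by
        rw [Finset.sum_const, Finset.card_range, nsmul_eq_mul, ← ENNReal.ofReal_natCast m,
          ← ENNReal.ofReal_ofNat 2, ← ENNReal.ofReal_mul two_pos.le,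
          ← ENNReal.ofReal_mul hm'.le]
        congr 1
        field_simp

end Osc

/-! ### The polygonal approximation of the limit -/

/-- The path obtained from a polygon by integrating `k` times and detrending, as a function of the
increments of the polygon. -/
noncomputable def detrendedPolygon (r k m : ℕ) (b : Fin m → ℝ) : CadlagPath :=
  .ofContinuous (detrended r k (polygon m b)) (continuous_detrended r k (continuous_polygon m b))

theorem continuous_detrendedPolygon (r k m : ℕ) : Continuous (detrendedPolygon r k m) := by
  refine CadlagPath.continuous_of_abs_sub_le (C := (1 + (r + 1) * gramInvBound r) * m)
    fun b b' t => ?_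
  have h := abs_detrended_sub_le r k (continuous_polygon m b) (continuous_polygon m b')
    (δ := dist b b' * m) (fun x hx => by
      rw [← polygon_sub]
      refine abs_polygon_le (fun i => ?_) hx
      exact dist_le_pi_dist b b' i) t.2
  refine h.trans (le_of_eq ?_)
  ring

/-- The increments of a path over the mesh intervals `[i / m, (i + 1) / m]`. -/
noncomputable def meshIncrement (m : ℕ) (w : ℝ≥0 → ℝ) (i : ℕ) : ℝ :=
  w (((i + 1 : ℕ) : ℝ≥0) / m) - w ((i : ℝ≥0) / m)

/-- The polygons through a continuous path converge to it, uniformly on `[0, 1]`, so that their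
images under integration and detrending converge in the Skorokhod space. -/
theorem tendsto_detrendedPolygon (r k : ℕ) {w : ℝ≥0 → ℝ} (hw : Continuous w) (hw0 : w 0 = 0)
    {y : CadlagPath} (hy : ∀ τ : unitInterval, y τ = detrended r k (fun s => w s.toNNReal) τ) :
    Tendsto (fun m => detrendedPolygon r k m fun i => meshIncrement m w i) atTop (𝓝 y) := by
  set C : ℝ := 1 + (r + 1) * gramInvBound r with hC
  have hC0 : 0 < C := by have := gramInvBound_nonneg r; positivity
  set g : ℝ → ℝ := fun s => w s.toNNReal with hg
  have hgc : Continuous g := hw.comp continuous_real_toNNReal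
  rw [EMetric.tendsto_atTop]
  intro ε hε
  obtain ⟨ε', hε'0, hε'⟩ : ∃ ε' > (0 : ℝ), ENNReal.ofReal ε' < ε := by
    obtain ⟨q, hq0, hq⟩ := ENNReal.lt_iff_exists_nnreal_btwn.1 hε
    exact ⟨q, by exact_mod_cast hq0, by simpa using hq⟩
  have huc := isCompact_Icc.uniformContinuousOn_of_continuous (hgc.continuousOn (s := Icc 0 1))
  obtain ⟨ρ, hρ0, hρ⟩ := Metric.uniformContinuousOn_iff_le.1 huc (ε' / (2 * C)) (by positivity)
  refine ⟨⌈1 / ρ⌉₊ + 1, fun m hm => lt_of_le_of_lt ?_ hε'⟩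
  have hm0 : 0 < m := by omega
  have hm' : (0 : ℝ) < m := by exact_mod_cast hm0
  have hmρ : 1 / (m : ℝ) ≤ ρ := by
    have h1 : 1 / ρ ≤ m := (Nat.le_ceil _).trans (by exact_mod_cast (Nat.le_succ _).trans hm)
    rwa [div_le_iff₀ hρ0, mul_comm, ← div_le_iff₀ hm'] at h1
  set v : ℕ → ℝ := fun i => g (i / m) with hv
  have hcast : ∀ i : ℕ, ((i : ℝ) / m).toNNReal = (i : ℝ≥0) / m := fun i => by
    rw [Real.toNNReal_div (Nat.cast_nonneg _), Real.toNNReal_natCast, Real.toNNReal_natCast]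
  have hb : (fun i : Fin m => meshIncrement m w i) = fun i : Fin m => v (i + 1) - v i := by
    ext i
    simp only [hv, hg, hcast, meshIncrement]
  have hv0 : v 0 = 0 := by simp [hv, hg, hw0]
  have hmem : ∀ i ≤ m, (i : ℝ) / m ∈ Icc (0 : ℝ) 1 := fun i hi => natCast_div_mem_Icc hi
  have hosc : ∀ x ∈ Icc (0 : ℝ) 1, ∀ y ∈ Icc (0 : ℝ) 1, |x - y| ≤ 1 / m →
      |g x - g y| ≤ ε' / (2 * C) := fun x hx y hy hxy => hρ x hx y hy (hxy.trans hmρ)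
  have happrox : ∀ x ∈ Icc (0 : ℝ) 1,
      |polygon m (fun i : Fin m => v (i + 1) - v i) x - g x| ≤ 2 * (ε' / (2 * C)) := by
    intro x hx
    rw [abs_sub_comm]
    have hfl := Nat.floor_le (mul_nonneg hm'.le hx.1)
    have hfl' := Nat.lt_floor_add_one (m * x)
    set i := ⌊m * x⌋₊ with hi
    have him : i ≤ m := Nat.floor_le_of_le (mul_le_of_le_one_right hm'.le hx.2)
    have hxi : |x - i / m| ≤ 1 / m := by
      rw [abs_of_nonneg (sub_nonneg.2 ((div_le_iff₀ hm').2 (by linarith))),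
        sub_le_iff_le_add, ← add_div, le_div_iff₀ hm']
      linarith
    refine abs_sub_polygon_le hm0 hv0 (fun j hj => ?_) him hxi (hosc x hx _ (hmem i him) hxi)
    refine hosc _ (hmem (j + 1) hj) _ (hmem j hj.le) (le_of_eq ?_)
    rw [← sub_div, Nat.cast_succ, add_sub_cancel_left, abs_of_nonneg (by positivity)]
  rw [hb]
  refine CadlagPath.edist_le_of_abs_sub_le fun τ => ?_
  rw [hy]
  refine (abs_detrended_sub_le r k (continuous_polygon m _) hgc happrox τ.2).trans (le_of_eq ?_)
  rw [← hC]
  field_simp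

section Brownian

variable {Ω' : Type*} [MeasurableSpace Ω'] {Q : Measure Ω'} {W : ℝ≥0 → Ω' → ℝ}

theorem ProbabilityTheory.IsPreBrownianReal.hasLaw_meshIncrement (hW : IsPreBrownianReal W Q)
    (m i : ℕ) :
    HasLaw (fun ω => meshIncrement m (fun t => W t ω) i) (gaussianReal 0 (m : ℝ≥0)⁻¹) Q := by
  have h := hW.hasLaw_sub (((i + 1 : ℕ) : ℝ≥0) / m) ((i : ℝ≥0) / m)
  have e : nndist ((((i + 1 : ℕ) : ℝ≥0) / m : ℝ≥0) : ℝ) (((i : ℝ≥0) / m : ℝ≥0) : ℝ) =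
      (m : ℝ≥0)⁻¹ := by
    ext
    rw [coe_nndist, Real.dist_eq]
    push_cast
    rw [← sub_div, add_sub_cancel_left, abs_of_nonneg (by positivity), one_div]
  rw [← e]
  exact h

theorem ProbabilityTheory.IsPreBrownianReal.iIndepFun_meshIncrement
    (hW : IsPreBrownianReal W Q) (m : ℕ) :
    iIndepFun (fun (i : Fin m) ω => meshIncrement m (fun t => W t ω) i) Q :=
  (hW.hasIndepIncrements.nat (t := fun i : ℕ => (i : ℝ≥0) / m)
    fun _ _ h => by dsimp only; gcongr).precomp Fin.val_injective

variable [IsProbabilityMeasure Q] {Ω : Type*} [MeasurableSpace Ω] {P : Measure Ω}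
  [IsProbabilityMeasure P]

/-- Joint convergence in law of the block sums to the increments of the Wiener process. -/
theorem IsWhiteNoise.tendstoInDistribution_blockSums {X : ℕ → Ω → ℝ} {σ : ℝ}
    (hX : IsWhiteNoise X σ P) (hσ : 0 < σ) (hW : IsPreBrownianReal W Q) {m : ℕ} (hm : 0 < m) :
    TendstoInDistribution
      (fun (T : ℕ) ω (i : Fin m) => blockSum m T σ (fun j => X j ω) i) atTop
      (fun ω i => meshIncrement m (fun t => W t ω) i) (fun _ => P) Q := by
  refine tendstoInDistribution_pi (Y := fun T (i : Fin m) ω => blockSum m T σ (fun j => X j ω) i)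
    (fun T => ?_) (hW.iIndepFun_meshIncrement m) fun i => ?_
  · have h := (iIndepFun_sum_Ico hX.indep (fun j => (hX.memLp j).1.aemeasurable)
      (monotone_knot m T)).precomp (g := fun i : Fin m => (i : ℕ)) Fin.val_injective
    exact h.comp (fun _ x => x / (σ * √T)) fun _ => by fun_prop
  · have h := hX.tendstoInDistribution_blockSum hσ hm i
    have hl := hW.hasLaw_meshIncrement m i
    exact h.of_map_eq h.forall_aemeasurable hl.aemeasurable (fun _ => rfl)
      (by rw [hl.map_eq, Measure.map_id])

end Brownian

/-! ### Negligibility of the noise -/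

theorem tendsto_measure_abs_gt_mul_sqrt {Ω : Type*} [MeasurableSpace Ω] {P : Measure Ω}
    [IsProbabilityMeasure P] {Y : Ω → ℝ} (hY : AEMeasurable Y P) {δ : ℝ} (hδ : 0 < δ) :
    Tendsto (fun T : ℕ => P {ω | δ * √T < |Y ω|}) atTop (𝓝 0) := by
  have h := tendsto_measure_iInter_atTop (μ := P) (s := fun T : ℕ => {ω | δ * √T < |Y ω|})
    (fun T => hY.nullMeasurable (measurableSet_lt measurable_const measurable_id.abs))
    (fun S T hST ω hω => by
      have hω' : δ * √T < |Y ω| := hω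
      refine lt_of_le_of_lt ?_ hω'
      gcongr) ⟨0, measure_ne_top _ _⟩
  have he : ⋂ T : ℕ, {ω | δ * √T < |Y ω|} = ∅ := by
    refine eq_empty_of_forall_notMem fun ω hω => ?_
    have h1 : Tendsto (fun T : ℕ => δ * √T) atTop atTop :=
      (Real.tendsto_sqrt_atTop.comp tendsto_natCast_atTop_atTop).const_mul_atTop hδ
    obtain ⟨T, hT⟩ := (h1.eventually_ge_atTop |Y ω|).exists
    exact not_lt.2 hT (mem_iInter.1 hω T)
  rwa [he, measure_empty] at h

/-- The noise is of smaller order than `√T`, uniformly up to time `T`. -/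
theorem IsWhiteNoise.tendsto_measure_exists_abs_gt {Ω : Type*} [MeasurableSpace Ω]
    {P : Measure Ω} [IsProbabilityMeasure P] {ε : ℕ → Ω → ℝ} {σ : ℝ}
    (hε : IsWhiteNoise (fun t => ε (t + 1)) σ P) (hε0 : AEMeasurable (ε 0) P) {δ : ℝ}
    (hδ : 0 < δ) :
    Tendsto (fun T : ℕ => P {ω | ∃ t ≤ T, δ * √T < |ε t ω|}) atTop (𝓝 0) := by
  have h := (tendsto_measure_abs_gt_mul_sqrt hε0 hδ).add
    (_root_.tendsto_measure_exists_abs_gt hε.identDistrib (hε.memLp 0) hδ)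
  rw [add_zero] at h
  refine tendsto_of_tendsto_of_tendsto_of_le_of_le tendsto_const_nhds h (fun _ => zero_le)
    fun T => (measure_mono ?_).trans (measure_union_le _ _)
  rintro ω ⟨t, ht, hω⟩
  rcases t with _ | t
  · exact Or.inl hω
  · exact Or.inr ⟨t, ht, hω⟩

/-! ### Convergence of the residual process -/

theorem aemeasurable_integratedWalk {Ω : Type*} [MeasurableSpace Ω] {P : Measure Ω}
    {η : ℕ → Ω → ℝ} (hη : ∀ t, AEMeasurable (η (t + 1)) P) (d : ℕ) :
    ∀ t, 1 ≤ t ∨ 1 ≤ d → AEMeasurable (fun ω => integratedWalk (fun t => η t ω) d t) P := by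
  induction d with
  | zero =>
    intro t ht
    obtain ⟨t, rfl⟩ := Nat.exists_eq_add_of_le' (show 1 ≤ t by omega)
    exact hη t
  | succ d ih =>
    intro t _
    exact Finset.aemeasurable_fun_sum _ fun k hk => ih k (Or.inl (Finset.mem_Icc.1 hk).1)

theorem mainTheorem4
    {Ω : Type*} [MeasurableSpace Ω] (P : Measure Ω) [IsProbabilityMeasure P]
    {Ω' : Type*} [MeasurableSpace Ω'] (Q : Measure Ω') [IsProbabilityMeasure Q]
    (r d : ℕ) (hd : 1 ≤ d)
    (η ε : ℕ → Ω → ℝ) (σ_η σ_ε : ℝ) (hσ_η : 0 < σ_η) (hσ_ε : 0 < σ_ε)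
    (hη : IsWhiteNoise (fun t => η (t + 1)) σ_η P)
    (hε : IsWhiteNoise (fun t => ε (t + 1)) σ_ε P)
    (hηε : ∀ s t : ℕ, cov[η (s + 1), ε (t + 1); P] = 0)
    -- `ε 0` only enters the path on `0 ≤ τ < 1 / T`, and may be any random variable
    (hε0 : AEMeasurable (ε 0) P)
    (α : Fin (r + 1) → ℝ)
    -- the least squares estimator for each sample size
    (αhat : ℕ → Ω → Fin (r + 1) → ℝ)
    (hαhat_meas : ∀ T, AEMeasurable (αhat T) P)
    (hαhat : ∀ T ω,
      IsLeastSquares T (trendSeries α d (fun t => η t ω) (fun t => ε t ω) T) (αhat T ω))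
    (W : ℝ≥0 → Ω' → ℝ) (hW : IsBrownianReal W Q)
    -- the detrended Wiener process, as a random element of the Skorokhod space
    (V : Ω' → CadlagPath)
    (hV : ∀ᵐ ω ∂Q, ∀ τ : unitInterval,
      V ω τ = detrended r (d - 1) (fun s => W s.toNNReal ω) τ) :
    TendstoInDistribution
      (fun (T : ℕ) (ω : Ω) => CadlagPath.step T fun t =>
        trendResidual T (trendSeries α d (fun t => η t ω) (fun t => ε t ω) T) (αhat T ω) t /
          (σ_η * (T : ℝ) ^ ((d : ℝ) - 1 / 2)))
      atTop V (fun _ => P) Q := by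
  obtain ⟨k, rfl⟩ := Nat.exists_eq_add_of_le' hd
  rw [add_tsub_cancel_right] at hV
  obtain ⟨C, hC, T₀, hclose⟩ := exists_abs_step_sub_detrended_le r k
  refine tendstoInDistribution_of_approx
    (U := fun m T ω => detrendedPolygon r k m fun i => blockSum m T σ_η (fun j => η (j + 1) ω) i)
    (Z' := fun m ω => detrendedPolygon r k m fun i => meshIncrement m (fun t => W t ω) i)
    (fun T => ?_) (fun m hm => ?_) ?_ fun δ hδ θ hθ => ?_
  · -- measurability of the residual path
    refine CadlagPath.aemeasurable_step fun t _ => AEMeasurable.div_const ?_ _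
    have hS := aemeasurable_integratedWalk (fun t => (hη.memLp t).1.aemeasurable) (k + 1) t
      (Or.inr hd)
    have hεt : AEMeasurable (ε t) P := by
      rcases t with _ | t
      · exact hε0
      · exact (hε.memLp t).1.aemeasurable
    refine ((hS.const_add _).add hεt).sub ?_
    exact Finset.aemeasurable_fun_sum _ fun j _ =>
      ((aemeasurable_pi_iff.1 (hαhat_meas T)) j).mul_const _
  · exact (hη.tendstoInDistribution_blockSums hσ_η hW.toIsPreBrownianReal hm).continuous_comp
      (continuous_detrendedPolygon r k m)
  · filter_upwards [hW.cont, hW.toIsPreBrownianReal.eval_zero_ae_eq_zero, hV] with ω h1 h2 h3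
    exact tendsto_detrendedPolygon r k h1 h2 h3
  · -- with block oscillations and noise below `o`, the paths are within `2 C o ≤ δ`
    set o : ℝ := δ / (2 * C + 1) with ho
    have ho0 : 0 < o := by positivity
    have hCo : C * (o + o) ≤ δ := by
      have : o * (2 * C + 1) = δ := by rw [ho]; field_simp
      nlinarith
    filter_upwards [hη.eventually_measure_not_blockOscLE_le hσ_η (half_pos ho0) (half_pos hθ),
      eventually_gt_atTop 0] with m hosc hm
    have hnoise := (hε.tendsto_measure_exists_abs_gt hε0 (mul_pos ho0 hσ_η)).eventually
      (ge_mem_nhds (ENNReal.ofReal_pos.2 (half_pos hθ)))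
    filter_upwards [hosc, hnoise, eventually_ge_atTop m, eventually_ge_atTop T₀] with
      T hosc hnoise hmT hT
    have hsum : ENNReal.ofReal θ = ENNReal.ofReal (θ / 2) + ENNReal.ofReal (θ / 2) := by
      rw [← ENNReal.ofReal_add (half_pos hθ).le (half_pos hθ).le, add_halves]
    rw [hsum]
    refine le_trans (measure_mono fun ω hω => ?_) ((measure_union_le _ _).trans
      (add_le_add hosc hnoise))
    by_contra hcon
    simp only [mem_union, mem_ofPred_eq, not_or, not_not, not_exists, not_and, not_lt] at hcon
    rw [mul_div_cancel₀ _ (two_ne_zero' ℝ)] at hcon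
    have hω' : ENNReal.ofReal δ < edist _ _ := hω
    refine absurd hω' (not_lt.2 (CadlagPath.edist_le_of_abs_sub_le fun τ => ?_))
    refine le_trans ?_ hCo
    exact hclose T hT m hm hmT (fun t => η t ω) (fun t => ε t ω) σ_η hσ_η α (αhat T ω)
      (hαhat T ω) o o hcon.1 (fun t ht => (hcon.2 t ht).trans_eq (mul_assoc _ _ _)) τ τ.2
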